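/- Let $d\ge 1$. On $\mathbb C^d$ use the norm $\|z\|=\sum_i|z_i|$ and write $z\cdot k=\sum_i z_ik_i$. For $r>0$ let $\mathcal D(r)=\{\theta\in\mathbb C^d:\|\operatorname{Im}\theta\|<r/2\pi\}$. Let $\mathcal A_d(r)$, respectively $\mathcal A_d'(r)$, be the Banach space of the analytic functions $f:\mathcal D(r)\to\mathbb C^d$, $1$-periodic in each variable, $f(\theta)=\sum_{k\in\mathbb Z^d}f_ke^{2\pi i k\cdot\theta}$, for which $$\|f\|_r=\sum_k\|f_k\|e^{r\|k\|},\quad\text{respectively}\quad \|f\|_r'=\sum_k(1+2\pi\|k\|)\|f_k\|e^{r\|k\|},$$ is finite. For $\sigma>0$ and $\omega\in\mathbb C^d$ let $I^-_\sigma(\omega)=\{k\in\mathbb Z^d:|\omega\cdot k|>\sigma\|k\|\}$, $I^+_\sigma(\omega)=\mathbb Z^d\setminus I^-_\sigma(\omega)$, and $[\mathbb I^\pm_\sigma(\omega)]f(\theta)=\sum_{k\in I^\pm_\sigma(\omega)}f_ke^{2\pi i k\cdot\theta}$. Let $0<\rho'<\rho$, $\omega\in\mathbb C^d\setminus\{0\}$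 and $0<\sigma<\|\omega\|$, and let $\hat B\subset\mathcal A_d'(\rho)$ be the open ball centred at the constant field $\omega$ with radius $$\hat\varepsilon=\frac{\sqrt6-2}{12}\,\sigma\,\min\Big\{\frac{\rho-\rho'}{4\pi},\ \frac{3-\sqrt6}{6}\,\frac{\sigma}{\|\omega\|}\Big\}.$$ Then for every $X\in\hat B$ there is an analytic map $U=U_X:\mathcal D(\rho')\to\mathcal D(\rho)$, biholomorphic onto its (open) image, with $DU$ invertible at every point, which is close to the identity in the sense that $U-\mathrm{id}\in\mathcal A_d'(\rho')$ and $$\|U-\mathrm{id}\|'_{\rho'}\le\frac{6(\sqrt6+2)}{\sigma}\,\|X-\omega\|'_\rho ,$$ such that $(DU)^{-1}\,X\circ U\in\mathcal A_d(\rho')$, $$[\mathbb I^-_\sigma(\omega)]\,(DU)^{-1}\,X\circ U=0,\qquad\text{and}\qquad U=\mathrm{id}\ \text{ if }\ [\mathbb I^-_\sigma(\omega)]X=0 .$$ The maps $U_X$ can be chosen so that, moreover, the map $\mathcal U:\hat B\to[\mathbb I^+_\sigma(\omega)]\mathcal A_d(\rho')$, $X\mapsto(DU_X)^{-1}\,X\circ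 U_X$, is analytic, its derivative at every constant vector field $\omega+\psi\in\hat B$ ($\psi\in\mathbb C^d$) is $\mathbb I^+_\sigma(\omega)$ (followed by restriction to $\mathcal D(\rho')$), and for all $X\in\hat B$ $$\|\mathcal U(X)-\omega\|_{\rho'}\le 2\Big(1+\max\Big\{\tfrac23(3-\sqrt6),\ 6(\sqrt6+2)\frac{\|\omega\|}{\sigma}\Big\}\Big)\|X-\omega\|'_\rho .$$ -/

import Mathlib

namespace TorusField

noncomputable section

/-- `ℂ^d` with the `ℓ₁`-norm `‖z‖ = ∑ |z_i|`. -/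
abbrev Vec (d : ℕ) : Type := PiLp 1 (fun _ : Fin d => ℂ)

/-- The `ℓ₁`-norm of an integer vector. -/
def freqNorm {d : ℕ} (k : Fin d → ℤ) : ℝ := ∑ i, |(k i : ℝ)|

/-- The bilinear product `z · k = ∑ z_i k_i`. -/
def dot {d : ℕ} (z : Vec d) (k : Fin d → ℤ) : ℂ := ∑ i, z i * (k i : ℂ)

/-- The complex neighbourhood `𝒟(r) = {θ ∈ ℂ^d : ‖Im θ‖ < r / 2π}` of `ℝ^d`. -/
def strip (d : ℕ) (r : ℝ) : Set (Vec d) :=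
  {θ | ∑ i, |(θ i).im| < r / (2 * Real.pi)}

/-- A point of `ℝ^d` as a point of `ℂ^d`. -/
def realPt {d : ℕ} (x : Fin d → ℝ) : Vec d := WithLp.toLp 1 fun i => (x i : ℂ)

/-- The character `θ ↦ e^{2πi k·θ}`. -/
def character {d : ℕ} (k : Fin d → ℤ) (θ : Vec d) : ℂ :=
  Complex.exp (2 * Real.pi * Complex.I * dot θ k)

/-- The Fourier coefficient `f_k = ∫_{(0,1]^d} e^{-2πi k·x} f(x) dx`. -/
def coeff {d : ℕ} (f : Vec d → Vec d) (k : Fin d → ℤ) : Vec d :=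
  ∫ x in {x : Fin d → ℝ | ∀ i, x i ∈ Set.Ioc (0 : ℝ) 1}, character (-k) (realPt x) • f (realPt x)

/-- The weight `(1 + 2π‖k‖)^j e^{r‖k‖}`; `j = 0` gives the norm `‖·‖_r`,
and `j = 1` gives the norm `‖·‖'_r`. -/
def weight {d : ℕ} (j : ℕ) (r : ℝ) (k : Fin d → ℤ) : ℝ :=
  (1 + 2 * Real.pi * freqNorm k) ^ j * Real.exp (r * freqNorm k)

/-- Functions `𝒟(r) → ℂ^d` (extended by `0` outside of `𝒟(r)`) that are holomorphic,
`1`-periodic in each variable, and have a finite weighted `ℓ₁`-sum of Fourier coefficients. -/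
structure IsField {d : ℕ} (j : ℕ) (r : ℝ) (f : Vec d → Vec d) : Prop where
  holo : DifferentiableOn ℂ f (strip d r)
  zero_off : ∀ θ, θ ∉ strip d r → f θ = 0
  periodic : ∀ (θ : Vec d) (n : Fin d → ℤ), f (θ + realPt fun i => (n i : ℝ)) = f θ
  summable : Summable fun k => weight j r k * ‖coeff f k‖

theorem weight_pos {d : ℕ} (j : ℕ) (r : ℝ) (k : Fin d → ℤ) : 0 < weight j r k := by
  have h : 0 ≤ freqNorm k := Finset.sum_nonneg fun i _ => abs_nonneg _
  unfold weight
  positivity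

theorem realPt_mem {d : ℕ} {r : ℝ} (hr : 0 < r) (x : Fin d → ℝ) : realPt x ∈ strip d r := by
  simp only [strip, realPt, Set.mem_ofPred_eq, Complex.ofReal_im, abs_zero, Finset.sum_const_zero]
  positivity

theorem strip_eq_empty {d : ℕ} {r : ℝ} (hr : r ≤ 0) (θ : Vec d) : θ ∉ strip d r := by
  simp only [strip, Set.mem_ofPred_eq, not_lt]
  exact (div_nonpos_of_nonpos_of_nonneg hr (by positivity)).trans
    (Finset.sum_nonneg fun i _ => abs_nonneg _)

theorem isOpen_strip (d : ℕ) (r : ℝ) : IsOpen (strip d r) := by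
  apply isOpen_lt _ continuous_const
  fun_prop

theorem continuous_realPt {d : ℕ} : Continuous (realPt : (Fin d → ℝ) → Vec d) := by
  unfold realPt
  fun_prop

theorem character_realPt {d : ℕ} (k : Fin d → ℤ) (x : Fin d → ℝ) :
    character k (realPt x) = UnitAddTorus.mFourier k fun i => (x i : UnitAddCircle) := by
  simp only [character, dot, realPt, UnitAddTorus.mFourier, ContinuousMap.coe_mk,
    fourier_coe_apply, Finset.mul_sum, Complex.exp_sum]
  refine Finset.prod_congr rfl fun i _ => ?_
  congr 1
  push_cast
  ring

theorem coeff_zero {d : ℕ} (k : Fin d → ℤ) : coeff (0 : Vec d → Vec d) k = 0 := by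
  simp [coeff]

theorem IsField.continuous_real {d j : ℕ} {r : ℝ} {f : Vec d → Vec d} (hf : IsField j r f) :
    Continuous fun x : Fin d → ℝ => f (realPt x) := by
  rcases le_or_gt r 0 with hr | hr
  · have : (fun x : Fin d → ℝ => f (realPt x)) = fun _ => 0 :=
      funext fun x => hf.zero_off _ (strip_eq_empty hr _)
    rw [this]
    exact continuous_const
  · exact hf.holo.continuousOn.comp_continuous continuous_realPt (realPt_mem hr)

theorem IsField.integrable {d j : ℕ} {r : ℝ} {f : Vec d → Vec d} (hf : IsField j r f)
    (k : Fin d → ℤ) :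
    MeasureTheory.IntegrableOn (fun x : Fin d → ℝ => character k (realPt x) • f (realPt x))
      {x : Fin d → ℝ | ∀ i, x i ∈ Set.Ioc (0 : ℝ) 1} := by
  have hc : Continuous fun x : Fin d → ℝ => character k (realPt x) • f (realPt x) := by
    have h1 : Continuous fun x : Fin d → ℝ => character k (realPt x) := by
      unfold character dot realPt
      fun_prop
    exact h1.smul hf.continuous_real
  refine (hc.continuousOn.integrableOn_compact
    (isCompact_Icc (a := (0 : Fin d → ℝ)) (b := 1))).mono_set ?_
  exact fun x hx => ⟨fun i => (hx i).1.le, fun i => (hx i).2⟩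

theorem IsField.coeff_add {d j : ℕ} {r : ℝ} {f g : Vec d → Vec d} (hf : IsField j r f)
    (hg : IsField j r g) (k : Fin d → ℤ) : coeff (f + g) k = coeff f k + coeff g k := by
  simp only [coeff, Pi.add_apply, smul_add]
  exact MeasureTheory.integral_add (hf.integrable _) (hg.integrable _)

theorem coeff_smul {d : ℕ} (c : ℂ) (f : Vec d → Vec d) (k : Fin d → ℤ) :
    coeff (c • f) k = c • coeff f k := by
  simp only [coeff, Pi.smul_apply, ← MeasureTheory.integral_smul]
  simp only [smul_comm c]

theorem IsField.zero {d j : ℕ} {r : ℝ} : IsField j r (0 : Vec d → Vec d) where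
  holo := differentiableOn_const 0
  zero_off _ _ := rfl
  periodic _ _ := rfl
  summable := by simp [coeff_zero, summable_zero]

theorem IsField.add {d j : ℕ} {r : ℝ} {f g : Vec d → Vec d} (hf : IsField j r f)
    (hg : IsField j r g) : IsField j r (f + g) where
  holo := hf.holo.add hg.holo
  zero_off θ h := by simp [hf.zero_off θ h, hg.zero_off θ h]
  periodic θ n := by simp [hf.periodic, hg.periodic]
  summable := by
    refine Summable.of_nonneg_of_le (fun k => mul_nonneg (weight_pos _ _ _).le (norm_nonneg _))
      (fun k => ?_) (hf.summable.add hg.summable)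
    rw [hf.coeff_add hg, ← mul_add]
    exact mul_le_mul_of_nonneg_left (norm_add_le _ _) (weight_pos _ _ _).le

theorem IsField.smul {d j : ℕ} {r : ℝ} {f : Vec d → Vec d} (c : ℂ) (hf : IsField j r f) :
    IsField j r (c • f) where
  holo := hf.holo.const_smul c
  zero_off θ h := by simp [hf.zero_off θ h]
  periodic θ n := by simp [hf.periodic]
  summable := by
    refine (hf.summable.mul_left ‖c‖).congr fun k => ?_
    rw [coeff_smul, norm_smul]
    ring

theorem IsField.real_eq_zero {d j : ℕ} {r : ℝ} {f : Vec d → Vec d} (hf : IsField j r f)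
    (h : ∀ k, coeff f k = 0) : ∀ x : Fin d → ℝ, f (realPt x) = 0 := by
  have hq : IsOpenQuotientMap
      (Pi.map fun (_ : Fin d) (t : ℝ) => (t : UnitAddCircle)) :=
    IsOpenQuotientMap.piMap fun _ => QuotientAddGroup.isOpenQuotientMap_mk
  intro x
  ext i
  have hc : Continuous fun x : Fin d → ℝ => f (realPt x) i :=
    (PiLp.proj (𝕜 := ℂ) 1 (fun _ : Fin d => ℂ) i).continuous.comp hf.continuous_real
  let F : C(Fin d → ℝ, ℂ) := ⟨fun x => f (realPt x) i, hc⟩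
  let Q : C(Fin d → ℝ, UnitAddTorus (Fin d)) := ⟨_, hq.continuous⟩
  have hQ : Topology.IsQuotientMap Q := hq.isQuotientMap
  have hF : Function.FactorsThrough F Q := by
    intro a b hab
    have hn : ∀ i, ∃ n : ℤ, a i = b i + n := by
      intro i
      have hi : (a i : UnitAddCircle) = (b i : UnitAddCircle) := congrFun hab i
      obtain ⟨n, hn⟩ := AddSubgroup.mem_zmultiples_iff.mp (QuotientAddGroup.eq.mp hi.symm)
      refine ⟨n, ?_⟩
      rw [zsmul_one] at hn
      linarith
    choose n hn using hn
    have : realPt a = realPt b + realPt fun i => (n i : ℝ) := by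
      ext i
      simp [realPt, hn]
    simp only [F, ContinuousMap.coe_mk, this, hf.periodic]
  let g : C(UnitAddTorus (Fin d), ℂ) := hQ.lift F hF
  have hg : ∀ x : Fin d → ℝ, g (fun i => (x i : UnitAddCircle)) = f (realPt x) i := by
    intro x
    exact congrArg (fun G : C(Fin d → ℝ, ℂ) => G x) (hQ.lift_comp F hF)
  have hco : UnitAddTorus.mFourierCoeff g = 0 := by
    funext k
    rw [UnitAddTorus.mFourierCoeff_eq_integral _ _ 0]
    have h1 := congrArg (PiLp.proj (𝕜 := ℂ) 1 (fun _ : Fin d => ℂ) i) (h k)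
    rw [coeff, ← ContinuousLinearMap.integral_comp_comm _ (hf.integrable _)] at h1
    simpa [hg, character_realPt] using h1
  have hs : Summable (UnitAddTorus.mFourierCoeff g) := by
    rw [hco]
    exact summable_zero
  have := UnitAddTorus.hasSum_mFourier_series_apply_of_summable hs
    (fun i => (x i : UnitAddCircle))
  rw [hco, hg] at this
  simpa using this.unique (by simp)

/-- A function of the space is determined by its Fourier coefficients. -/
theorem IsField.eq_zero {d j : ℕ} {r : ℝ} {f : Vec d → Vec d} (hf : IsField j r f)
    (h : ∀ k, coeff f k = 0) : f = 0 := by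
  have hreal := hf.real_eq_zero h
  funext z
  by_cases hz : z ∈ strip d r
  swap
  · exact hf.zero_off z hz
  let L : ℂ → Vec d := fun t => realPt (fun i => (z i).re) + t • realPt (fun i => (z i).im)
  let S : Set ℂ := L ⁻¹' strip d r
  have hL : Differentiable ℂ L := by
    intro t
    exact (differentiableAt_const _).add (differentiableAt_id.smul_const _)
  have hSo : IsOpen S := (isOpen_strip d r).preimage hL.continuous
  have hLim : ∀ t i, ((L t) i).im = t.im * (z i).im := by
    intro t i
    simp [L, realPt]
  have hr : 0 < r := by
    by_contra hr
    exact strip_eq_empty (not_lt.mp hr) z hz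
  have hSmem : ∀ t, t ∈ S ↔ |t.im| * ∑ i, |(z i).im| < r / (2 * Real.pi) := by
    intro t
    change ∑ i, |((L t) i).im| < _ ↔ _
    simp only [hLim, abs_mul, Finset.mul_sum]
  have hSc : IsPreconnected S := by
    apply Convex.isPreconnected
    intro s hs t ht a b ha hb hab
    rw [hSmem] at *
    have hM : 0 ≤ ∑ i, |(z i).im| := Finset.sum_nonneg fun i _ => abs_nonneg _
    have h1 : |(a • s + b • t).im| ≤ a * |s.im| + b * |t.im| := by
      have : (a • s + b • t).im = a * s.im + b * t.im := by simp
      rw [this]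
      refine (abs_add_le _ _).trans (le_of_eq ?_)
      rw [abs_mul, abs_mul, abs_of_nonneg ha, abs_of_nonneg hb]
    calc _ ≤ (a * |s.im| + b * |t.im|) * ∑ i, |(z i).im| :=
          mul_le_mul_of_nonneg_right h1 hM
      _ = a * (|s.im| * ∑ i, |(z i).im|) + b * (|t.im| * ∑ i, |(z i).im|) := by ring
      _ < r / (2 * Real.pi) := by
          rcases ha.eq_or_lt with rfl | ha'
          · have : b = 1 := by linarith
            subst this
            simpa using ht
          · have := mul_lt_mul_of_pos_left hs ha'
            have := mul_le_mul_of_nonneg_left ht.le hb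
            have : a * (r / (2 * Real.pi)) + b * (r / (2 * Real.pi)) = r / (2 * Real.pi) := by
              rw [← add_mul, hab, one_mul]
            linarith
  have hG : AnalyticOnNhd ℂ (f ∘ L) S :=
    (hf.holo.comp hL.differentiableOn fun t ht => ht).analyticOnNhd hSo
  have h0 : (0 : ℂ) ∈ S := by
    rw [hSmem]
    simp only [Complex.zero_im, abs_zero, zero_mul]
    positivity
  have hI : Complex.I ∈ S := by
    rw [hSmem]
    simpa [strip] using hz
  have hLr : ∀ s : ℝ, (f ∘ L) (s : ℂ) = 0 := by
    intro s
    have : L (s : ℂ) = realPt fun i => (z i).re + s * (z i).im := by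
      ext i
      simp [L, realPt]
    simp only [Function.comp_apply, this, hreal]
  have hfr : ∃ᶠ t in nhdsWithin (0 : ℂ) {0}ᶜ, (f ∘ L) t = 0 := by
    have ht : Filter.Tendsto (fun s : ℝ => (s : ℂ)) (nhdsWithin 0 {0}ᶜ)
        (nhdsWithin (0 : ℂ) {0}ᶜ) := by
      refine tendsto_nhdsWithin_iff.mpr ⟨?_, ?_⟩
      · exact (Complex.continuous_ofReal.tendsto' 0 0 (by simp)).mono_left nhdsWithin_le_nhds
      · filter_upwards [self_mem_nhdsWithin] with s hs
        simpa using hs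
    exact ht.frequently (Filter.Frequently.of_forall hLr)
  have := hG.eqOn_zero_of_preconnected_of_frequently_eq_zero hSc h0 hfr hI
  have hLI : L Complex.I = z := by
    ext i
    apply Complex.ext <;> simp [L, realPt]
  simpa [hLI] using this

/-- The space of the functions above: `𝒜_d(r)` for `j = 0` and `𝒜'_d(r)` for `j = 1`. -/
def FieldSpace (d j : ℕ) (r : ℝ) : Type :=
  ↥({ carrier := {f | IsField j r f}
      add_mem' := IsField.add
      zero_mem' := IsField.zero
      smul_mem' := fun c _ hf => IsField.smul c hf } : Submodule ℂ (Vec d → Vec d))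

instance (d j : ℕ) (r : ℝ) : AddCommGroup (FieldSpace d j r) :=
  inferInstanceAs (AddCommGroup ↥(Submodule.mk _ _ : Submodule ℂ (Vec d → Vec d)))

instance (d j : ℕ) (r : ℝ) : Module ℂ (FieldSpace d j r) :=
  inferInstanceAs (Module ℂ ↥(Submodule.mk _ _ : Submodule ℂ (Vec d → Vec d)))

instance (d j : ℕ) (r : ℝ) : CoeFun (FieldSpace d j r) fun _ => Vec d → Vec d :=
  ⟨fun f => f.1⟩

/-- The norm `∑_k (1 + 2π‖k‖)^j e^{r‖k‖} ‖f_k‖`. -/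
instance (d j : ℕ) (r : ℝ) : Norm (FieldSpace d j r) :=
  ⟨fun f => ∑' k, weight j r k * ‖coeff f k‖⟩

theorem FieldSpace.core (d j : ℕ) (r : ℝ) : NormedSpace.Core ℂ (FieldSpace d j r) where
  norm_nonneg f := tsum_nonneg fun k => mul_nonneg (weight_pos _ _ _).le (norm_nonneg _)
  norm_smul c f := by
    change ∑' k, weight j r k * ‖coeff (c • f.1) k‖ = ‖c‖ * ∑' k, weight j r k * ‖coeff f.1 k‖
    rw [← tsum_mul_left]
    refine tsum_congr fun k => ?_
    rw [coeff_smul, norm_smul]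
    ring
  norm_triangle f g := by
    change ∑' k, weight j r k * ‖coeff (f.1 + g.1) k‖ ≤
      ∑' k, weight j r k * ‖coeff f.1 k‖ + ∑' k, weight j r k * ‖coeff g.1 k‖
    have hf : IsField j r f.1 := f.2
    have hg : IsField j r g.1 := g.2
    rw [← hf.summable.tsum_add hg.summable]
    refine (hf.add hg).summable.tsum_le_tsum (fun k => ?_) (hf.summable.add hg.summable)
    rw [hf.coeff_add hg, ← mul_add]
    exact mul_le_mul_of_nonneg_left (norm_add_le _ _) (weight_pos _ _ _).le
  norm_eq_zero_iff f := by
    have hf : IsField j r f.1 := f.2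
    constructor
    · intro h
      have h' : ∀ k, weight j r k * ‖coeff f.1 k‖ = 0 := by
        have := (hasSum_zero_iff_of_nonneg
          (fun k => mul_nonneg (weight_pos j r k).le (norm_nonneg (coeff f.1 k)))).mp
          ((show ∑' k, weight j r k * ‖coeff f.1 k‖ = 0 from h) ▸ hf.summable.hasSum)
        exact fun k => congrFun this k
      refine Subtype.ext (hf.eq_zero fun k => ?_)
      simpa [(weight_pos j r k).ne'] using h' k
    · rintro rfl
      change ∑' k, weight j r k * ‖coeff (0 : Vec d → Vec d) k‖ = 0
      simp [coeff_zero]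

instance (d j : ℕ) (r : ℝ) : NormedAddCommGroup (FieldSpace d j r) :=
  NormedAddCommGroup.ofCore (FieldSpace.core d j r)

instance (d j : ℕ) (r : ℝ) : NormedSpace ℂ (FieldSpace d j r) :=
  NormedSpace.ofCore (FieldSpace.core d j r)

/-- `𝒜_d(r)` with the norm `∑_k ‖f_k‖ e^{r‖k‖}`. -/
abbrev A (d : ℕ) (r : ℝ) : Type := FieldSpace d 0 r

/-- `𝒜'_d(r)` with the norm `∑_k (1 + 2π‖k‖) ‖f_k‖ e^{r‖k‖}`. -/
abbrev A' (d : ℕ) (r : ℝ) : Type := FieldSpace d 1 r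

theorem isField_const {d : ℕ} (j : ℕ) (r : ℝ) (v : Vec d) :
    IsField j r ((strip d r).indicator fun _ => v) where
  holo := (differentiableOn_const v).congr fun θ h => Set.indicator_of_mem h _
  zero_off θ h := Set.indicator_of_notMem h _
  periodic θ n := by
    have : (θ + realPt fun i => (n i : ℝ)) ∈ strip d r ↔ θ ∈ strip d r := by
      simp [strip, realPt]
    by_cases h : θ ∈ strip d r
    · rw [Set.indicator_of_mem h, Set.indicator_of_mem (this.mpr h)]
    · rw [Set.indicator_of_notMem h, Set.indicator_of_notMem (mt this.mp h)]
  summable := by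
    rcases le_or_gt r 0 with hr | hr
    · have : (strip d r).indicator (fun _ => v) = 0 :=
        funext fun θ => Set.indicator_of_notMem (strip_eq_empty hr θ) _
      rw [this]
      exact IsField.zero.summable
    refine summable_of_ne_finset_zero (s := {0}) fun k hk => ?_
    have hk : k ≠ 0 := by simpa using hk
    have h1 : UnitAddTorus.mFourierCoeff (UnitAddTorus.mFourier (0 : Fin d → ℤ)) k = 0 := by
      have h0 := UnitAddTorus.mFourierBasis_repr (UnitAddTorus.mFourierBasis (0 : Fin d → ℤ)) k
      rw [HilbertBasis.repr_self, UnitAddTorus.coe_mFourierBasis] at h0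
      refine (UnitAddTorus.mFourierCoeff_toLp (UnitAddTorus.mFourier 0) k).symm.trans
        (h0.symm.trans ?_)
      simp [hk]
    rw [UnitAddTorus.mFourierCoeff_eq_integral _ _ 0] at h1
    have h2 : coeff ((strip d r).indicator fun _ => v) k = 0 := by
      simp only [coeff, Set.indicator_of_mem (realPt_mem hr _), integral_smul_const,
        character_realPt]
      simp only [UnitAddTorus.mFourier_zero, ContinuousMap.one_apply, smul_eq_mul, mul_one,
        Pi.zero_apply, zero_add] at h1
      rw [h1, zero_smul]
    rw [h2, norm_zero, mul_zero]

/-- The constant vector field `v` on `𝒟(r)`. -/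
def constField {d : ℕ} (j : ℕ) (r : ℝ) (v : Vec d) : FieldSpace d j r :=
  ⟨(strip d r).indicator fun _ => v, isField_const j r v⟩

/-- The indices of the far from resonance terms, `I⁻_σ(ψ) = {k : |ψ·k| > σ‖k‖}`. -/
def farIndices {d : ℕ} (σ : ℝ) (ψ : Vec d) : Set (Fin d → ℤ) :=
  {k | σ * freqNorm k < ‖dot ψ k‖}

/-- The indices of the resonant terms, `I⁺_σ(ψ) = ℤ^d \ I⁻_σ(ψ)`. -/
def resonantIndices {d : ℕ} (σ : ℝ) (ψ : Vec d) : Set (Fin d → ℤ) := (farIndices σ ψ)ᶜ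

/-- The Fourier projection `θ ↦ ∑_{k ∈ I} f_k e^{2πi k·θ}`; the projections
`𝕀^±_σ(ψ)` are those for `I = I^±_σ(ψ)`. -/
def fourierProj {d : ℕ} (I : Set (Fin d → ℤ)) (f : Vec d → Vec d) (θ : Vec d) : Vec d :=
  ∑' k : I, character k.1 θ • coeff f k.1

/-- `U` is an invertible analytic coordinate change from `S` into `T`: a biholomorphic map
of `S` onto its image, which lies in `T`. -/
structure IsCoordChange {d : ℕ} (U : Vec d → Vec d) (S T : Set (Vec d)) : Prop where
  mapsTo : Set.MapsTo U S T
  holo : DifferentiableOn ℂ U S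
  isOpen_image : IsOpen (U '' S)
  exists_inverse : ∃ V : Vec d → Vec d, DifferentiableOn ℂ V (U '' S) ∧ ∀ θ ∈ S, V (U θ) = θ

/-- The vector field `(DU)⁻¹ X ∘ U`. -/
def pullback {d : ℕ} (U X : Vec d → Vec d) (θ : Vec d) : Vec d :=
  (fderiv ℂ U θ).inverse (X (U θ))

/-- The radius `ε̂` of the ball of vector fields. -/
def radius (ρ ρ' σ w : ℝ) : ℝ :=
  (√6 - 2) / 12 * σ * min ((ρ - ρ') / (4 * Real.pi)) ((3 - √6) / 6 * (σ / w))

end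

end TorusField

open TorusField

/-!
Write `U = id + u` and `J_u g = (Du) g`. With
`R(X, u) = (1 + J_u)⁻¹ (J_u² ω + (X - ω) ∘ (id + u))` one has
`(DU)⁻¹ X ∘ U = ω - J_u ω + R(X, u)`, and `J_u ω = (ω · ∂) u`, so the far from resonance terms
vanish as soon as `u = (ω · ∂)⁻¹ 𝕀⁻ R(X, u)`. On `I⁻_σ(ω)` the divisors satisfy
`|ω · k| > σ ‖k‖`, so `(ω · ∂)⁻¹ 𝕀⁻` gains one derivative at the cost of a factor of order `1 / σ`.
Since `R(X, u)` is `X - ω` up to quadratic terms, Cauchy's estimate turns this equation into a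
contraction on a small ball, and the implicit function theorem makes the solution analytic in `X`.
The composition `f ∘ (id + u)` is analytic in `u` because
`f (θ + u) = ∑_k f_k e^{2πi k·θ} exp (2πi k·u)`
is a normally convergent power series for `‖u‖' < (ρ - ρ') / 4π`.
-/

namespace TorusField

noncomputable section

open Metric NormedSpace
open scoped Topology Real

section Analysis

variable {𝕜 E F : Type*}

theorem summable_pi_prod {ι α : Type*} [Fintype ι] {g : ι → α → ℝ} (hg : ∀ i a, 0 ≤ g i a)
    (hs : ∀ i, Summable (g i)) : Summable fun k : ι → α => ∏ i, g i (k i) := by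
  classical
  refine summable_of_sum_le (c := ∏ i, ∑' a, g i a)
    (fun k => Finset.prod_nonneg fun i _ => hg i _) fun s => ?_
  calc ∑ k ∈ s, ∏ i, g i (k i)
      ≤ ∑ k ∈ Fintype.piFinset fun i => s.image (· i), ∏ i, g i (k i) :=
        Finset.sum_le_sum_of_subset_of_nonneg
          (fun k hk => Fintype.mem_piFinset.mpr fun i => Finset.mem_image_of_mem _ hk)
          fun k _ _ => Finset.prod_nonneg fun i _ => hg i _
    _ = ∏ i, ∑ a ∈ s.image (· i), g i a := (Finset.prod_univ_sum _ _).symm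
    _ ≤ ∏ i, ∑' a, g i a := Finset.prod_le_prod
        (fun i _ => Finset.sum_nonneg fun a _ => hg i a)
        fun i _ => (hs i).sum_le_tsum _ fun a _ => hg i a

theorem hasFPowerSeriesOnBall_tsum [NontriviallyNormedField 𝕜] [NormedAddCommGroup E]
    [NormedSpace 𝕜 E] [NormedAddCommGroup F] [NormedSpace 𝕜 F] [CompleteSpace F] {ι : Type*}
    {f : ι → E → F} {p : ι → FormalMultilinearSeries 𝕜 E F} {R : NNReal} (hR : 0 < R)
    (hp : Summable fun x : ι × ℕ => ‖p x.1 x.2‖ * (R : ℝ) ^ x.2)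
    (hf : ∀ i y, HasSum (fun n => p i n fun _ => y) (f i y)) :
    HasFPowerSeriesOnBall (fun y => ∑' i, f i y) (fun n => ∑' i, p i n) 0 R := by
  have hn : ∀ n, Summable fun i => ‖p i n‖ := fun n =>
    (summable_mul_right_iff (a := (R : ℝ) ^ n) (by positivity)).mp (hp.prod_symm.prod_factor n)
  refine ⟨?_, by exact_mod_cast hR, fun {y} hy => ?_⟩
  · refine FormalMultilinearSeries.le_radius_of_summable _
      (Summable.of_nonneg_of_le (fun n => by positivity) (fun n => ?_) hp.prod_symm.prod)
    simp only [Prod.fst_swap, Prod.snd_swap]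
    rw [tsum_mul_right]
    exact mul_le_mul_of_nonneg_right (norm_tsum_le_tsum_norm (hn n)) (by positivity)
  · have hyR : ‖y‖ ≤ R := by
      have : ‖y‖ < R := by simpa using hy
      exact this.le
    have hs : Summable fun x : ι × ℕ => p x.1 x.2 fun _ => y := by
      refine Summable.of_norm_bounded hp fun x => ?_
      refine ((p x.1 x.2).le_opNorm _).trans ?_
      simp only [Finset.prod_const, Finset.card_univ, Fintype.card_fin]
      gcongr
    rw [zero_add, (hs.hasSum.prod_fiberwise fun i => hf i y).tsum_eq,
      ← (Equiv.prodComm ℕ ι).tsum_eq]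
    exact hs.prod_symm.hasSum.prod_fiberwise fun n =>
      ContinuousMultilinearMap.hasSum_eval (hn n).of_norm.hasSum fun _ => y

theorem hasFDerivAt_clm_apply_of_eq_zero [NontriviallyNormedField 𝕜] {G : Type*}
    [NormedAddCommGroup E] [NormedSpace 𝕜 E] [NormedAddCommGroup F] [NormedSpace 𝕜 F]
    [NormedAddCommGroup G] [NormedSpace 𝕜 G] {A : G → E →L[𝕜] F} {g : G → E} {g' : G →L[𝕜] E}
    {x : G} (hA : DifferentiableAt 𝕜 A x) (hg : HasFDerivAt g g' x) (h0 : g x = 0) :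
    HasFDerivAt (fun y => A y (g y)) (A x ∘L g') x := by
  convert! hA.hasFDerivAt.clm_apply hg using 1
  ext v
  simp [h0]

theorem hasSum_exp_series (x : ℝ) :
    HasSum (fun n : ℕ => (n.factorial : ℝ)⁻¹ * x ^ n) (Real.exp x) := by
  rw [Real.exp_eq_exp_ℝ]
  exact exp_series_hasSum_exp' (𝕂 := ℝ) x

section Exp

variable [RCLike 𝕜] [NormedAddCommGroup E] [NormedSpace 𝕜 E] [NormedAddCommGroup F]
  [NormedSpace 𝕜 F]

theorem norm_expSeries_clm_le (n : ℕ) :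
    ‖expSeries 𝕜 (E →L[𝕜] E) n‖ ≤ (n.factorial : ℝ)⁻¹ := by
  have h : ‖ContinuousMultilinearMap.mkPiAlgebraFin 𝕜 n (E →L[𝕜] E)‖ ≤ 1 := by
    rcases Nat.eq_zero_or_pos n with rfl | hn
    · rw [ContinuousMultilinearMap.norm_mkPiAlgebraFin_zero]
      exact ContinuousLinearMap.norm_id_le
    · exact ContinuousMultilinearMap.norm_mkPiAlgebraFin_le_of_pos hn
  refine (ContinuousMultilinearMap.opNorm_smul_le ((n.factorial : 𝕜)⁻¹) _).trans ?_
  simpa using mul_le_mul_of_nonneg_left h (by positivity : (0 : ℝ) ≤ (n.factorial : ℝ)⁻¹)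

variable [CompleteSpace E]

theorem norm_exp_clm_le (S : E →L[𝕜] E) : ‖exp S‖ ≤ Real.exp ‖S‖ := by
  rw [← (expSeries_hasSum_exp (𝕂 := 𝕜) S).tsum_eq]
  refine tsum_of_norm_bounded (hasSum_exp_series ‖S‖) fun n => ?_
  refine ((expSeries 𝕜 (E →L[𝕜] E) n).le_opNorm _).trans ?_
  simp only [Finset.prod_const, Finset.card_univ, Fintype.card_fin]
  gcongr
  exact norm_expSeries_clm_le n

theorem map_exp_apply_of_map_apply_eq_smul {S : E →L[𝕜] E} {L : E →L[𝕜] F} {c : 𝕜}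
    (h : ∀ g, L (S g) = c • L g) (g : E) : L (exp S g) = exp c • L g := by
  have hpow : ∀ n : ℕ, L ((S ^ n) g) = c ^ n • L g := by
    intro n
    induction n with
    | zero => simp
    | succ n ih => rw [pow_succ', mul_apply_eq_comp, h, ih, smul_smul, pow_succ']
  have hleft := ((exp_series_hasSum_exp' (𝕂 := 𝕜) S).mapL
    (ContinuousLinearMap.apply 𝕜 E g)).mapL L
  have hright := (exp_series_hasSum_exp' (𝕂 := 𝕜) c).smul_const (L g)
  refine hleft.unique (hright.congr_fun fun n => ?_)
  rw [map_smul, map_smul, ContinuousLinearMap.apply_apply, hpow, smul_smul, smul_eq_mul]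

end Exp

section Neumann

theorem isUnit_one_add_of_norm_lt_one {A : Type*} [NormedRing A] [HasSummableGeomSeries A] {a : A}
    (ha : ‖a‖ < 1) : IsUnit (1 + a) := by
  simpa using isUnit_one_sub_of_norm_lt_one (x := -a) (by simpa using ha)

variable [NontriviallyNormedField 𝕜] [NormedAddCommGroup E] [NormedSpace 𝕜 E]

theorem isInvertible_of_isUnit {S : E →L[𝕜] E} (h : IsUnit S) : S.IsInvertible := by
  obtain ⟨a, rfl⟩ := h
  exact ⟨ContinuousLinearEquiv.ofUnit a, rfl⟩

theorem norm_inverse_one_add_le [CompleteSpace E] {S : E →L[𝕜] E} (hS : ‖S‖ < 1) :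
    ‖Ring.inverse (1 + S)‖ ≤ (1 - ‖S‖)⁻¹ := by
  have hneg : ‖-S‖ < 1 := by rwa [norm_neg]
  have hone : ‖(1 : E →L[𝕜] E)‖ ≤ 1 := ContinuousLinearMap.norm_id_le
  have hgeom := tsum_geometric_le_of_norm_lt_one (-S) hneg
  rw [← sub_neg_eq_add, NormedRing.inverse_one_sub _ hneg]
  change ‖∑' n : ℕ, (-S) ^ n‖ ≤ _
  rw [norm_neg] at hgeom
  linarith

end Neumann

section FixedPoint

theorem contDiffAt_fixedPoint [RCLike 𝕜] [NormedAddCommGroup E] [NormedSpace 𝕜 E]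
    [CompleteSpace E] [NormedAddCommGroup F] [NormedSpace 𝕜 F] [CompleteSpace F]
    {n : WithTop ℕ∞} (hn : n ≠ 0) {T : F × E → E} {φ : F → E} {x : F}
    (hT : ContDiffAt 𝕜 n T (x, φ x)) (hT' : ‖fderiv 𝕜 (fun v => T (x, v)) (φ x)‖ < 1)
    (hfix : T (x, φ x) = φ x) (huniq : ∀ᶠ z in 𝓝 (x, φ x), T z = z.2 → z.2 = φ z.1) :
    ContDiffAt 𝕜 n φ x := by
  have hG : ContDiffAt 𝕜 n (fun z : F × E => z.2 - T z) (x, φ x) := contDiffAt_snd.sub hT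
  have hTd : HasFDerivAt T (fderiv 𝕜 T (x, φ x)) (x, φ x) :=
    (hT.differentiableAt hn).hasFDerivAt
  have hpartial : fderiv 𝕜 (fun z : F × E => z.2 - T z) (x, φ x) ∘L .inr 𝕜 F E =
      1 + -fderiv 𝕜 (fun v => T (x, v)) (φ x) := by
    have hslice : HasFDerivAt (fun v => T (x, v)) (fderiv 𝕜 T (x, φ x) ∘L .inr 𝕜 F E) (φ x) :=
      hTd.comp (φ x) (hasFDerivAt_prodMk_right x (φ x))
    rw [hslice.fderiv, (hasFDerivAt_snd.fun_sub hTd).fderiv]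
    ext v
    simp [sub_eq_add_neg]
  have hinv : (fderiv 𝕜 (fun z : F × E => z.2 - T z) (x, φ x) ∘L .inr 𝕜 F E).IsInvertible := by
    rw [hpartial]
    exact isInvertible_of_isUnit (isUnit_one_add_of_norm_lt_one (by rwa [norm_neg]))
  have hψ := hG.contDiffAt_implicitFunction hn hinv
  have hψx := hG.implicitFunction_apply_self hn hinv
  have hψT := hG.eventually_apply_implicitFunction hn hinv
  set ψ := hG.implicitFunction hn hinv
  simp only [hfix, sub_self] at hψ hψx hψT
  have htendsto : Filter.Tendsto (fun y => (y, ψ y)) (𝓝 x) (𝓝 (x, φ x)) :=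
    hψx ▸ Filter.tendsto_id.prodMk_nhds hψ.continuousAt.tendsto
  refine hψ.congr_of_eventuallyEq ?_
  filter_upwards [hψT, htendsto.eventually huniq] with y hy hyuniq
  exact (hyuniq (sub_eq_zero.mp hy).symm).symm

variable [NormedAddCommGroup E] [NormedSpace ℂ E]

theorem norm_fderiv_le_of_mapsTo_ball [NormedAddCommGroup F] [NormedSpace ℂ F] {T : E → F}
    {a u : E} {b : F} {R M : ℝ} (hd : DifferentiableOn ℂ T (ball a R))
    (hT : Set.MapsTo T (ball a R) (closedBall b M)) (hu : u ∈ ball a R) :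
    ‖fderiv ℂ T u‖ ≤ 2 * M / (R - dist u a) := by
  have hsub : ball u (R - dist u a) ⊆ ball a R := ball_subset_ball' (by linarith)
  refine Complex.norm_fderiv_le_div_of_mapsTo_ball (hd.mono hsub) (fun v hv => ?_)
    (sub_pos.mpr hu)
  have hv' : dist (T v) b ≤ M := hT (hsub hv)
  have hu' : dist (T u) b ≤ M := hT hu
  rw [mem_closedBall]
  linarith [dist_triangle_right (T v) (T u) b]

variable {T : E → E} {a : E} {R M : ℝ}

theorem norm_fderiv_le_of_mem_closedBall (hd : DifferentiableOn ℂ T (ball a R))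
    (hT : Set.MapsTo T (ball a R) (closedBall a M)) (hMR : M < R) {u : E}
    (hu : u ∈ closedBall a M) : ‖fderiv ℂ T u‖ ≤ 2 * M / (R - M) := by
  have hu' : dist u a ≤ M := hu
  have hM : 0 ≤ M := dist_nonneg.trans hu'
  refine (norm_fderiv_le_of_mapsTo_ball hd hT (closedBall_subset_ball hMR hu)).trans ?_
  gcongr

theorem lipschitzOnWith_of_mapsTo_ball {K : NNReal} (hd : DifferentiableOn ℂ T (ball a R))
    (hT : Set.MapsTo T (ball a R) (closedBall a M)) (hMR : M < R) (hK : 2 * M / (R - M) ≤ K) :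
    LipschitzOnWith K T (closedBall a M) := by
  have := NormedSpace.restrictScalars ℝ ℂ E
  exact (convex_closedBall a M).lipschitzOnWith_of_nnnorm_fderiv_le (𝕜 := ℂ)
    (fun u hu => hd.differentiableAt (isOpen_ball.mem_nhds (closedBall_subset_ball hMR hu)))
    fun u hu => (norm_fderiv_le_of_mem_closedBall hd hT hMR hu).trans hK

theorem existsUnique_fixedPoint_of_mapsTo_ball [CompleteSpace E]
    (hd : DifferentiableOn ℂ T (ball a R)) (hT : Set.MapsTo T (ball a R) (closedBall a M))
    (hM : 0 ≤ M) (hMR : 3 * M < R) : ∃! u, u ∈ ball a R ∧ T u = u := by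
  have hMR' : M < R := by linarith
  have hsub : closedBall a M ⊆ ball a R := closedBall_subset_ball hMR'
  have hK : 2 * M / (R - M) < 1 := (div_lt_one (by linarith)).mpr (by linarith)
  lift 2 * M / (R - M) to NNReal using div_nonneg (by linarith) (by linarith) with K hKM
  have hlip : LipschitzOnWith K T (closedBall a M) :=
    lipschitzOnWith_of_mapsTo_ball hd hT hMR' hKM.ge
  have hmaps : Set.MapsTo T (closedBall a M) (closedBall a M) := hT.mono_left hsub
  have hcontr : ContractingWith K (hmaps.restrict T _ _) :=
    ⟨by exact_mod_cast hK, hlip.mapsToRestrict hmaps⟩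
  obtain ⟨u, hu, hfix, -⟩ := hcontr.exists_fixedPoint' isClosed_closedBall.isComplete hmaps
    (mem_closedBall_self hM) (edist_ne_top _ _)
  refine ⟨u, ⟨hsub hu, hfix⟩, fun v ⟨hv, hvfix⟩ => ?_⟩
  have hvu : (⟨v, hvfix ▸ hT hv⟩ : closedBall a M) = ⟨u, hu⟩ :=
    hcontr.fixedPoint_unique' (Subtype.ext hvfix) (Subtype.ext hfix)
  exact congrArg Subtype.val hvu

end FixedPoint

end Analysis

variable {d : ℕ}

section Frequencies

theorem freqNorm_nonneg (k : Fin d → ℤ) : 0 ≤ freqNorm k :=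
  Finset.sum_nonneg fun _ _ => abs_nonneg _

@[simp]
theorem freqNorm_zero : freqNorm (0 : Fin d → ℤ) = 0 := by
  simp [freqNorm]

theorem abs_le_freqNorm (k : Fin d → ℤ) (i : Fin d) : |(k i : ℝ)| ≤ freqNorm k :=
  Finset.single_le_sum (f := fun i => |(k i : ℝ)|) (fun _ _ => abs_nonneg _) (Finset.mem_univ i)

theorem freqNorm_add_le (k l : Fin d → ℤ) : freqNorm (k + l) ≤ freqNorm k + freqNorm l := by
  simp only [freqNorm, ← Finset.sum_add_distrib]
  refine Finset.sum_le_sum fun i _ => ?_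
  rw [Pi.add_apply, Int.cast_add]
  exact abs_add_le _ _

theorem one_le_freqNorm {k : Fin d → ℤ} (hk : k ≠ 0) : 1 ≤ freqNorm k := by
  obtain ⟨i, hi⟩ := Function.ne_iff.mp hk
  have hki : (1 : ℝ) ≤ |(k i : ℝ)| := by exact_mod_cast Int.one_le_abs hi
  exact hki.trans (abs_le_freqNorm k i)

theorem exp_le_weight (j : ℕ) (r : ℝ) (k : Fin d → ℤ) :
    Real.exp (r * freqNorm k) ≤ weight j r k := by
  have := freqNorm_nonneg k
  exact le_mul_of_one_le_left (Real.exp_nonneg _)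
    (one_le_pow₀ (le_add_of_nonneg_right (by positivity)))

theorem one_le_weight (j : ℕ) {r : ℝ} (hr : 0 ≤ r) (k : Fin d → ℤ) : 1 ≤ weight j r k :=
  (Real.one_le_exp (mul_nonneg hr (freqNorm_nonneg k))).trans (exp_le_weight j r k)

theorem dot_add_left (z w : Vec d) (k : Fin d → ℤ) : dot (z + w) k = dot z k + dot w k := by
  simp [dot, add_mul, Finset.sum_add_distrib]

theorem dot_add_right (z : Vec d) (k l : Fin d → ℤ) : dot z (k + l) = dot z k + dot z l := by
  simp [dot, mul_add, Finset.sum_add_distrib]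

theorem norm_dot_le (z : Vec d) (k : Fin d → ℤ) : ‖dot z k‖ ≤ freqNorm k * ‖z‖ := by
  rw [PiLp.norm_eq_of_L1, Finset.mul_sum]
  refine (norm_sum_le _ _).trans (Finset.sum_le_sum fun i _ => ?_)
  rw [norm_mul, mul_comm, Complex.norm_intCast]
  exact mul_le_mul_of_nonneg_right (abs_le_freqNorm k i) (norm_nonneg _)

/-- The functional `z ↦ 2πi z·k`, the exponent of the character with frequency `k`. -/
def freqL (k : Fin d → ℤ) : Vec d →L[ℂ] ℂ :=
  LinearMap.mkContinuous
    { toFun := fun z => 2 * π * Complex.I * dot z k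
      map_add' := fun z w => by rw [dot_add_left, mul_add]
      map_smul' := fun c z => by
        simp only [dot, PiLp.smul_apply, smul_eq_mul, RingHom.id_apply, Finset.mul_sum]
        exact Finset.sum_congr rfl fun i _ => by ring }
    (2 * π * freqNorm k) fun z => by
      change ‖2 * π * Complex.I * dot z k‖ ≤ _
      rw [norm_mul, mul_assoc (2 * π)]
      refine mul_le_mul (le_of_eq ?_) (norm_dot_le z k) (norm_nonneg _) (by positivity)
      simp [abs_of_pos Real.pi_pos]

theorem freqL_apply (k : Fin d → ℤ) (z : Vec d) : freqL k z = 2 * π * Complex.I * dot z k := rfl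

theorem norm_freqL_le (k : Fin d → ℤ) : ‖freqL k‖ ≤ 2 * π * freqNorm k := by
  have := freqNorm_nonneg k
  exact LinearMap.mkContinuous_norm_le _ (by positivity) _

theorem character_eq_exp (k : Fin d → ℤ) (θ : Vec d) : character k θ = Complex.exp (freqL k θ) :=
  rfl

theorem character_zero (θ : Vec d) : character 0 θ = 1 := by simp [character, dot]

theorem character_add (k l : Fin d → ℤ) (θ : Vec d) :
    character (k + l) θ = character k θ * character l θ := by
  rw [character, character, character, dot_add_right, mul_add, Complex.exp_add]

theorem character_apply_add (k : Fin d → ℤ) (θ z : Vec d) :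
    character k (θ + z) = character k θ * Complex.exp (freqL k z) := by
  rw [character_eq_exp, character_eq_exp, map_add, Complex.exp_add]

theorem character_add_int (k : Fin d → ℤ) (θ : Vec d) (n : Fin d → ℤ) :
    character k (θ + realPt fun i => (n i : ℝ)) = character k θ := by
  have hdot : dot (realPt fun i => (n i : ℝ)) k = ((∑ i, n i * k i : ℤ) : ℂ) := by
    simp [dot, realPt]
  rw [character_apply_add, freqL_apply, hdot, mul_comm (2 * π * Complex.I),
    Complex.exp_int_mul_two_pi_mul_I, mul_one]

theorem hasFDerivAt_character (k : Fin d → ℤ) (θ : Vec d) :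
    HasFDerivAt (character k) (character k θ • freqL k) θ :=
  (freqL k).hasFDerivAt.cexp

theorem norm_character_realPt (k : Fin d → ℤ) (x : Fin d → ℝ) :
    ‖character k (realPt x)‖ = 1 := by
  rw [character, Complex.norm_exp, Real.exp_eq_one_iff]
  simp [dot, realPt, Complex.mul_re]

theorem continuous_character_realPt (k : Fin d → ℤ) :
    Continuous fun x : Fin d → ℝ => character k (realPt x) := by
  unfold character dot realPt
  fun_prop

end Frequencies

section Strip

variable {r s : ℝ} {θ : Vec d}

theorem mem_strip : θ ∈ strip d r ↔ ∑ i, |(θ i).im| < r / (2 * π) := Iff.rfl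

theorem strip_mono (hsr : s ≤ r) : strip d s ⊆ strip d r := fun _ hθ =>
  (mem_strip.mp hθ).trans_le (div_le_div_of_nonneg_right hsr (by positivity))

theorem exists_lt_mem_strip (hθ : θ ∈ strip d r) : ∃ s < r, θ ∈ strip d s := by
  obtain ⟨q, hq, hqr⟩ := exists_between (mem_strip.mp hθ)
  refine ⟨q * (2 * π), (lt_div_iff₀ (by positivity)).mp hqr, ?_⟩
  rwa [mem_strip, mul_div_cancel_right₀ _ (by positivity)]

theorem strip_add_int (r : ℝ) (θ : Vec d) (n : Fin d → ℤ) :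
    (θ + realPt fun i => (n i : ℝ)) ∈ strip d r ↔ θ ∈ strip d r := by
  simp [strip, realPt]

theorem add_mem_strip {z : Vec d} (hθ : θ ∈ strip d s) (hz : 2 * π * ‖z‖ ≤ r - s) :
    θ + z ∈ strip d r := by
  rw [mem_strip, lt_div_iff₀ (by positivity)] at hθ ⊢
  have him : ∑ i, |((θ + z) i).im| ≤ ∑ i, |(θ i).im| + ‖z‖ := by
    rw [PiLp.norm_eq_of_L1, ← Finset.sum_add_distrib]
    refine Finset.sum_le_sum fun i _ => ?_
    rw [PiLp.add_apply, Complex.add_im]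
    exact (abs_add_le _ _).trans (by gcongr; exact Complex.abs_im_le_norm _)
  have := mul_le_mul_of_nonneg_right him (by positivity : 0 ≤ 2 * π)
  linarith

theorem convex_strip (d : ℕ) (r : ℝ) : Convex ℝ (strip d r) := by
  have hconv : ConvexOn ℝ Set.univ fun θ : Vec d => ∑ i, |(θ i).im| := by
    refine ⟨convex_univ, fun x _ y _ a b ha hb _ => ?_⟩
    simp only [smul_eq_mul, Finset.mul_sum, ← Finset.sum_add_distrib]
    refine Finset.sum_le_sum fun i _ => ?_
    have him : ((a • x + b • y) i).im = a * (x i).im + b * (y i).im := by simp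
    rw [him]
    refine (abs_add_le _ _).trans (le_of_eq ?_)
    rw [abs_mul, abs_mul, abs_of_nonneg ha, abs_of_nonneg hb]
  simpa [strip] using hconv.convex_lt (r / (2 * π))

theorem norm_character_le (hθ : θ ∈ strip d r) (k : Fin d → ℤ) :
    ‖character k θ‖ ≤ Real.exp (r * freqNorm k) := by
  have hre : (freqL k θ).re = -(2 * π * ∑ i, (θ i).im * k i) := by
    simp [freqL_apply, dot, Complex.mul_re, Complex.mul_im]
  have him : |∑ i, (θ i).im * k i| ≤ (∑ i, |(θ i).im|) * freqNorm k := by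
    rw [Finset.sum_mul]
    refine (Finset.abs_sum_le_sum_abs _ _).trans (Finset.sum_le_sum fun i _ => ?_)
    rw [abs_mul]
    exact mul_le_mul_of_nonneg_left (abs_le_freqNorm k i) (abs_nonneg _)
  rw [character_eq_exp, Complex.norm_exp, Real.exp_le_exp, hre]
  rw [mem_strip, lt_div_iff₀ (by positivity)] at hθ
  calc -(2 * π * ∑ i, (θ i).im * k i) = 2 * π * -∑ i, (θ i).im * k i := by ring
    _ ≤ 2 * π * ((∑ i, |(θ i).im|) * freqNorm k) := by
        gcongr
        exact (neg_le_abs _).trans him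
    _ = (∑ i, |(θ i).im|) * (2 * π) * freqNorm k := by ring
    _ ≤ r * freqNorm k := mul_le_mul_of_nonneg_right hθ.le (freqNorm_nonneg k)

theorem norm_character_smul_freqL_le (hsr : s < r) (hθ : θ ∈ strip d s) (k : Fin d → ℤ) :
    ‖character k θ • freqL k‖ ≤ 2 * π / (r - s) * Real.exp (r * freqNorm k) := by
  have hrs : 0 < r - s := sub_pos.mpr hsr
  have := freqNorm_nonneg k
  have hgain : freqNorm k ≤ Real.exp ((r - s) * freqNorm k) / (r - s) := by
    rw [le_div_iff₀ hrs]
    linarith [Real.add_one_le_exp ((r - s) * freqNorm k)]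
  calc ‖character k θ • freqL k‖
      = ‖character k θ‖ * ‖freqL k‖ := norm_smul _ _
    _ ≤ Real.exp (s * freqNorm k) * (2 * π * (Real.exp ((r - s) * freqNorm k) / (r - s))) := by
        gcongr
        · exact norm_character_le hθ k
        · exact (norm_freqL_le k).trans (by gcongr)
    _ = 2 * π / (r - s) * (Real.exp (s * freqNorm k) * Real.exp ((r - s) * freqNorm k)) := by
        ring
    _ = 2 * π / (r - s) * Real.exp (r * freqNorm k) := by
        rw [← Real.exp_add]
        ring_nf

end Strip

section FourierSeries

/-- The sum of the Fourier series with coefficients `a`. -/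
def fourierSum (a : (Fin d → ℤ) → Vec d) (θ : Vec d) : Vec d := ∑' k, character k θ • a k

variable {j : ℕ} {r : ℝ} {a : (Fin d → ℤ) → Vec d} {θ : Vec d}

theorem summable_exp_mul_norm (ha : Summable fun k => weight j r k * ‖a k‖) :
    Summable fun k => Real.exp (r * freqNorm k) * ‖a k‖ :=
  Summable.of_nonneg_of_le (fun _ => by positivity)
    (fun k => mul_le_mul_of_nonneg_right (exp_le_weight j r k) (norm_nonneg _)) ha

theorem summable_norm_of_weight (hr : 0 ≤ r) (ha : Summable fun k => weight j r k * ‖a k‖) :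
    Summable fun k => ‖a k‖ :=
  Summable.of_nonneg_of_le (fun _ => norm_nonneg _)
    (fun k => le_mul_of_one_le_left (norm_nonneg _) (one_le_weight j hr k)) ha

theorem hasSum_fourierSum (ha : Summable fun k => Real.exp (r * freqNorm k) * ‖a k‖)
    (hθ : θ ∈ strip d r) : HasSum (fun k => character k θ • a k) (fourierSum a θ) := by
  refine (Summable.of_norm_bounded ha fun k => ?_).hasSum
  rw [norm_smul]
  exact mul_le_mul_of_nonneg_right (norm_character_le hθ k) (norm_nonneg _)

theorem hasSum_fderiv_fourierSum (ha : Summable fun k => Real.exp (r * freqNorm k) * ‖a k‖)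
    (hθ : θ ∈ strip d r) :
    ∃ L, HasSum (fun k => (character k θ • freqL k).smulRight (a k)) L ∧
      HasFDerivAt (fourierSum a) L θ := by
  obtain ⟨s, hsr, hθs⟩ := exists_lt_mem_strip hθ
  have hbound : ∀ k, ∀ z ∈ strip d s, ‖(character k z • freqL k).smulRight (a k)‖ ≤
      2 * π / (r - s) * (Real.exp (r * freqNorm k) * ‖a k‖) := fun k z hz => by
    rw [ContinuousLinearMap.norm_smulRight_apply, ← mul_assoc]
    exact mul_le_mul_of_nonneg_right (norm_character_smul_freqL_le hsr hz k) (norm_nonneg _)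
  exact ⟨_, (Summable.of_norm_bounded (ha.mul_left _) fun k => hbound k θ hθs).hasSum,
    hasFDerivAt_tsum_of_isPreconnected (ha.mul_left _) (isOpen_strip d s)
      (convex_strip d s).isPreconnected
      (fun k z _ => (hasFDerivAt_character k z).smul_const (a k)) hbound hθs
      (hasSum_fourierSum ha hθ).summable hθs⟩

theorem integral_character (k : Fin d → ℤ) :
    ∫ x in {x : Fin d → ℝ | ∀ i, x i ∈ Set.Ioc (0 : ℝ) 1}, character k (realPt x) =
      if k = 0 then 1 else 0 := by
  have hcoeff : UnitAddTorus.mFourierCoeff (UnitAddTorus.mFourier (0 : Fin d → ℤ)) (-k) =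
      if k = 0 then 1 else 0 := by
    have hrepr := UnitAddTorus.mFourierBasis_repr (UnitAddTorus.mFourierBasis (0 : Fin d → ℤ)) (-k)
    rw [HilbertBasis.repr_self, UnitAddTorus.coe_mFourierBasis] at hrepr
    refine (UnitAddTorus.mFourierCoeff_toLp (UnitAddTorus.mFourier 0) (-k)).symm.trans
      (hrepr.symm.trans ?_)
    by_cases hk : k = 0 <;> simp [hk]
  rw [UnitAddTorus.mFourierCoeff_eq_integral _ _ 0] at hcoeff
  rw [← hcoeff]
  simp [character_realPt, UnitAddTorus.mFourier_zero]

theorem integrableOn_character_smul (k : Fin d → ℤ) (v : Vec d) :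
    MeasureTheory.IntegrableOn (fun x : Fin d → ℝ => character k (realPt x) • v)
      {x | ∀ i, x i ∈ Set.Ioc (0 : ℝ) 1} := by
  have hc : Continuous fun x : Fin d → ℝ => character k (realPt x) • v :=
    (continuous_character_realPt k).smul continuous_const
  exact (hc.continuousOn.integrableOn_compact
    (isCompact_Icc (a := (0 : Fin d → ℝ)) (b := 1))).mono_set
    fun x hx => ⟨fun i => (hx i).1.le, fun i => (hx i).2⟩

theorem coeff_fourierSum (ha : Summable fun k => ‖a k‖) (l : Fin d → ℤ) :
    coeff (fourierSum a) l = a l := by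
  have hterm : ∀ k, ∫ x in {x : Fin d → ℝ | ∀ i, x i ∈ Set.Ioc (0 : ℝ) 1},
      character (k + -l) (realPt x) • a k = if k = l then a k else 0 := fun k => by
    rw [integral_smul_const, integral_character, ← sub_eq_add_neg]
    by_cases hk : k = l <;> simp [hk, sub_eq_zero]
  have hsum := MeasureTheory.hasSum_integral_of_summable_integral_norm
    (fun k => integrableOn_character_smul (k + -l) (a k)) (by
      simp only [norm_smul, norm_character_realPt, one_mul, MeasureTheory.integral_const]
      exact ha.const_smul _)
  simp only [hterm] at hsum
  calc coeff (fourierSum a) l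
      = ∫ x in {x : Fin d → ℝ | ∀ i, x i ∈ Set.Ioc (0 : ℝ) 1},
          ∑' k, character (k + -l) (realPt x) • a k := by
        simp only [coeff, fourierSum, ← tsum_const_smul'', smul_smul, character_add, mul_comm]
    _ = a l := by rw [← hsum.tsum_eq, tsum_ite_eq]

theorem coeff_congr {f g : Vec d → Vec d} (h : ∀ x, f (realPt x) = g (realPt x))
    (k : Fin d → ℤ) : coeff f k = coeff g k := by
  simp only [coeff, h]

theorem coeff_indicator_fourierSum (hr : 0 < r) (ha : Summable fun k => ‖a k‖) (k : Fin d → ℤ) :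
    coeff ((strip d r).indicator (fourierSum a)) k = a k := by
  rw [← coeff_fourierSum ha k]
  exact coeff_congr (fun x => Set.indicator_of_mem (realPt_mem hr x) _) k

theorem isField_fourierSum (ha : Summable fun k => weight j r k * ‖a k‖) :
    IsField j r ((strip d r).indicator (fourierSum a)) where
  holo θ hθ := by
    obtain ⟨L, -, hL⟩ := hasSum_fderiv_fourierSum (summable_exp_mul_norm ha) hθ
    exact hL.differentiableAt.differentiableWithinAt.congr
      (fun z hz => Set.indicator_of_mem hz _) (Set.indicator_of_mem hθ _)
  zero_off θ h := Set.indicator_of_notMem h _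
  periodic θ n := by
    by_cases h : θ ∈ strip d r
    · rw [Set.indicator_of_mem h, Set.indicator_of_mem ((strip_add_int r θ n).mpr h)]
      simp only [fourierSum, character_add_int]
    · rw [Set.indicator_of_notMem h, Set.indicator_of_notMem (mt (strip_add_int r θ n).mp h)]
  summable := by
    rcases le_or_gt r 0 with hr | hr
    · have hempty : strip d r = ∅ := Set.eq_empty_of_forall_notMem (strip_eq_empty hr)
      rw [hempty, Set.indicator_empty']
      exact (IsField.zero (j := j) (r := r)).summable
    · simpa only [coeff_indicator_fourierSum hr (summable_norm_of_weight hr.le ha)] using ha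

end FourierSeries

section FieldSpaces

variable {j : ℕ} {r : ℝ} {θ : Vec d}

namespace FieldSpace

theorem isField (f : FieldSpace d j r) : IsField j r f := f.2

theorem norm_def (f : FieldSpace d j r) : ‖f‖ = ∑' k, weight j r k * ‖coeff f k‖ := rfl

theorem coeff_add (f g : FieldSpace d j r) (k : Fin d → ℤ) :
    coeff (f + g) k = coeff f k + coeff g k := f.isField.coeff_add g.isField k

theorem weight_mul_norm_coeff_le (f : FieldSpace d j r) (k : Fin d → ℤ) :
    weight j r k * ‖coeff f k‖ ≤ ‖f‖ :=
  f.isField.summable.le_tsum k fun _ _ => mul_nonneg (weight_pos _ _ _).le (norm_nonneg _)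

end FieldSpace

/-- The `k`-th Fourier coefficient as a continuous linear map. -/
def coeffL (d j : ℕ) (r : ℝ) (k : Fin d → ℤ) : FieldSpace d j r →L[ℂ] Vec d :=
  LinearMap.mkContinuous
    { toFun := fun f => coeff f k
      map_add' := fun f g => f.coeff_add g k
      map_smul' := fun c f => coeff_smul c f k }
    (weight j r k)⁻¹ fun f => by
      rw [inv_mul_eq_div, le_div_iff₀ (weight_pos j r k), mul_comm]
      exact f.weight_mul_norm_coeff_le k

theorem coeffL_apply (k : Fin d → ℤ) (f : FieldSpace d j r) : coeffL d j r k f = coeff f k := rfl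

/-- The field on `𝒟(r)` with given Fourier coefficients; it is `0` if `𝒟(r)` is empty. -/
def ofCoeff (a : (Fin d → ℤ) → Vec d) (ha : Summable fun k => weight j r k * ‖a k‖) :
    FieldSpace d j r :=
  ⟨(strip d r).indicator (fourierSum a), isField_fourierSum ha⟩

theorem coeff_ofCoeff (hr : 0 < r) (a : (Fin d → ℤ) → Vec d)
    (ha : Summable fun k => weight j r k * ‖a k‖) (k : Fin d → ℤ) : coeff (ofCoeff a ha) k = a k :=
  coeff_indicator_fourierSum hr (summable_norm_of_weight hr.le ha) k

namespace FieldSpace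

theorem ext_of_forall_mem_strip {f g : FieldSpace d j r} (h : ∀ θ ∈ strip d r, f θ = g θ) :
    f = g := by
  refine Subtype.ext (funext fun θ => ?_)
  by_cases hθ : θ ∈ strip d r
  · exact h θ hθ
  · exact (f.isField.zero_off θ hθ).trans (g.isField.zero_off θ hθ).symm

theorem subsingleton_of_nonpos (hr : r ≤ 0) : Subsingleton (FieldSpace d j r) :=
  ⟨fun _ _ => ext_of_forall_mem_strip fun θ hθ => absurd hθ (strip_eq_empty hr θ)⟩

theorem ext_coeff {f g : FieldSpace d j r} (h : ∀ k, coeff f k = coeff g k) : f = g := by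
  rw [← sub_eq_zero]
  refine Subtype.ext ((f - g).isField.eq_zero fun k => ?_)
  rw [← coeffL_apply, map_sub, coeffL_apply, coeffL_apply, h, sub_self]

theorem eq_ofCoeff (f : FieldSpace d j r) : f = ofCoeff (coeff f) f.isField.summable := by
  rcases le_or_gt r 0 with hr | hr
  · exact (subsingleton_of_nonpos hr).elim _ _
  · exact ext_coeff fun k => (coeff_ofCoeff hr _ _ k).symm

theorem apply_eq_fourierSum (f : FieldSpace d j r) (hθ : θ ∈ strip d r) :
    f θ = fourierSum (coeff f) θ := by
  conv_lhs => rw [f.eq_ofCoeff]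
  exact Set.indicator_of_mem hθ _

theorem hasSum_apply (f : FieldSpace d j r) (hθ : θ ∈ strip d r) :
    HasSum (fun k => character k θ • coeff f k) (f θ) := by
  rw [f.apply_eq_fourierSum hθ]
  exact hasSum_fourierSum (summable_exp_mul_norm f.isField.summable) hθ

theorem differentiableAt (f : FieldSpace d j r) (hθ : θ ∈ strip d r) :
    DifferentiableAt ℂ f θ :=
  f.isField.holo.differentiableAt ((isOpen_strip d r).mem_nhds hθ)

theorem hasSum_fderiv (f : FieldSpace d j r) (hθ : θ ∈ strip d r) :
    HasSum (fun k => (character k θ • freqL k).smulRight (coeff f k)) (fderiv ℂ f θ) := by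
  obtain ⟨L, hsum, hL⟩ :=
    hasSum_fderiv_fourierSum (summable_exp_mul_norm f.isField.summable) hθ
  have hfL : HasFDerivAt f L θ := hL.congr_of_eventuallyEq <| by
    filter_upwards [(isOpen_strip d r).mem_nhds hθ] with z hz using f.apply_eq_fourierSum hz
  rwa [hfL.fderiv]

theorem norm_apply_le (f : FieldSpace d j r) (hθ : θ ∈ strip d r) : ‖f θ‖ ≤ ‖f‖ := by
  rw [← (f.hasSum_apply hθ).tsum_eq]
  refine tsum_of_norm_bounded f.isField.summable.hasSum fun k => ?_
  rw [norm_smul]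
  exact mul_le_mul_of_nonneg_right
    ((norm_character_le hθ k).trans (exp_le_weight j r k)) (norm_nonneg _)

end FieldSpace

/-- Evaluation at a point of the strip. -/
def evalL (j : ℕ) (hθ : θ ∈ strip d r) : FieldSpace d j r →L[ℂ] Vec d :=
  LinearMap.mkContinuous
    { toFun := fun f => f θ
      map_add' := fun _ _ => rfl
      map_smul' := fun _ _ => rfl } 1 fun f => by
      rw [one_mul]
      exact f.norm_apply_le hθ

theorem evalL_apply (hθ : θ ∈ strip d r) (f : FieldSpace d j r) : evalL j hθ f = f θ := rfl

theorem summable_weight_single (j : ℕ) (r : ℝ) (k : Fin d → ℤ) (v : Vec d) :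
    Summable fun l => weight j r l * ‖(Pi.single k v : (Fin d → ℤ) → Vec d) l‖ :=
  summable_of_ne_finset_zero (s := {k}) fun l hl => by
    have : l ≠ k := by simpa using hl
    simp [this]

theorem ofCoeff_single_apply (k : Fin d → ℤ) (v : Vec d) (hθ : θ ∈ strip d r) :
    ofCoeff (Pi.single k v) (summable_weight_single j r k v) θ = character k θ • v := by
  refine (Set.indicator_of_mem hθ _).trans ((tsum_eq_single k fun l hl => ?_).trans ?_)
  · rw [Pi.single_eq_of_ne hl, smul_zero]
  · rw [Pi.single_eq_same]

/-- The mode `v e^{2πi k·θ}` of frequency `k`, as a linear function of its amplitude `v`. -/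
def mode (d j : ℕ) (r : ℝ) (k : Fin d → ℤ) : Vec d →L[ℂ] FieldSpace d j r :=
  LinearMap.mkContinuous
    { toFun := fun v => ofCoeff (Pi.single k v) (summable_weight_single j r k v)
      map_add' := fun v w => FieldSpace.ext_of_forall_mem_strip fun θ hθ => by
        change _ = evalL j hθ (_ + _)
        rw [map_add]
        simp only [evalL_apply, ofCoeff_single_apply _ _ hθ, smul_add]
      map_smul' := fun c v => FieldSpace.ext_of_forall_mem_strip fun θ hθ => by
        change _ = evalL j hθ (c • _)
        rw [map_smul]
        simp only [evalL_apply, ofCoeff_single_apply _ _ hθ, smul_comm c] }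
    (weight j r k) fun v => by
      change ‖ofCoeff (Pi.single k v) (summable_weight_single j r k v)‖ ≤ _
      rcases le_or_gt r 0 with hr | hr
      · have := FieldSpace.subsingleton_of_nonpos (d := d) (j := j) hr
        rw [Subsingleton.elim (ofCoeff _ _) 0, norm_zero]
        exact mul_nonneg (weight_pos j r k).le (norm_nonneg v)
      · rw [FieldSpace.norm_def, tsum_eq_single k]
        · rw [coeff_ofCoeff hr, Pi.single_eq_same]
        · intro l hl
          rw [coeff_ofCoeff hr, Pi.single_eq_of_ne hl, norm_zero, mul_zero]

theorem mode_apply (k : Fin d → ℤ) (v : Vec d) (hθ : θ ∈ strip d r) :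
    mode d j r k v θ = character k θ • v :=
  ofCoeff_single_apply k v hθ

theorem coeff_mode (hr : 0 < r) (k : Fin d → ℤ) (v : Vec d) (l : Fin d → ℤ) :
    coeff (mode d j r k v) l = (Pi.single k v : (Fin d → ℤ) → Vec d) l :=
  coeff_ofCoeff hr _ (summable_weight_single j r k v) l

theorem norm_mode_le (k : Fin d → ℤ) : ‖mode d j r k‖ ≤ weight j r k :=
  LinearMap.mkContinuous_norm_le _ (weight_pos j r k).le _

theorem constField_apply (v : Vec d) (hθ : θ ∈ strip d r) : constField j r v θ = v :=
  Set.indicator_of_mem hθ fun _ => v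

theorem mode_zero_eq_constField (v : Vec d) : mode d j r 0 v = constField j r v :=
  FieldSpace.ext_of_forall_mem_strip fun θ hθ => by
    rw [mode_apply 0 v hθ, constField_apply v hθ, character_zero, one_smul]

section Complete

/-- The isometry of the space of fields into `ℓ₁` that takes a field to its weighted Fourier
coefficients. -/
def toLp (d j : ℕ) (r : ℝ) : FieldSpace d j r →ₗᵢ[ℂ] lp (fun _ : Fin d → ℤ => Vec d) 1 where
  toFun f := ⟨fun k => (weight j r k : ℂ) • coeff f k, by
    refine memℓp_gen (f.isField.summable.congr fun k => ?_)
    simp [norm_smul, abs_of_pos (weight_pos j r k)]⟩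
  map_add' f g := by
    ext1
    funext k
    change (weight j r k : ℂ) • coeff (f + g : FieldSpace d j r) k =
      (weight j r k : ℂ) • coeff f k + (weight j r k : ℂ) • coeff g k
    rw [FieldSpace.coeff_add, smul_add]
  map_smul' c f := by
    ext1
    funext k
    change (weight j r k : ℂ) • coeff (c • f : FieldSpace d j r) k =
      c • (weight j r k : ℂ) • coeff f k
    rw [← coeffL_apply, map_smul, smul_comm, coeffL_apply]
  norm_map' f := by
    rw [lp.norm_eq_tsum_rpow (by simp), FieldSpace.norm_def]
    simp [norm_smul, abs_of_pos (weight_pos j r _)]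

theorem surjective_toLp (hr : 0 < r) : Function.Surjective (toLp d j r) := by
  intro a
  have hs := (lp.memℓp a).summable (by simp)
  have hw : ∀ k : Fin d → ℤ, weight j r k ≠ 0 := fun k => (weight_pos j r k).ne'
  refine ⟨ofCoeff (fun k => (weight j r k : ℂ)⁻¹ • a k) (hs.congr fun k => ?_), ?_⟩
  · simp [norm_smul, abs_of_pos (weight_pos j r k), mul_inv_cancel_left₀ (hw k)]
  · ext1
    funext k
    change (weight j r k : ℂ) • coeff _ k = _
    rw [coeff_ofCoeff hr, smul_inv_smul₀ (Complex.ofReal_ne_zero.mpr (hw k))]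

instance FieldSpace.instCompleteSpace : CompleteSpace (FieldSpace d j r) := by
  rcases le_or_gt r 0 with hr | hr
  · have := FieldSpace.subsingleton_of_nonpos (d := d) (j := j) hr
    infer_instance
  · exact ((toLp d j r).isometry.isUniformInducing.completeSpace_congr (surjective_toLp hr)).mpr
      inferInstance

end Complete

section Lift

variable {E : Type*} [NormedAddCommGroup E] [NormedSpace ℂ E] {C : ℝ}
  {T : (Fin d → ℤ) → Vec d →L[ℂ] E}

theorem norm_apply_coeff_le (hT : ∀ k, ‖T k‖ ≤ C * weight j r k) (f : FieldSpace d j r)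
    (k : Fin d → ℤ) : ‖T k (coeff f k)‖ ≤ C * (weight j r k * ‖coeff f k‖) := by
  rw [← mul_assoc]
  exact (T k).le_of_opNorm_le (hT k) _

variable [CompleteSpace E]

theorem summable_apply_coeff (hT : ∀ k, ‖T k‖ ≤ C * weight j r k) (f : FieldSpace d j r) :
    Summable fun k => T k (coeff f k) :=
  Summable.of_norm_bounded (f.isField.summable.mul_left C) (norm_apply_coeff_le hT f)

/-- The continuous linear map `f ↦ ∑ T_k f_k` defined by a family of linear maps that is bounded
relative to the weights. -/
def lift (C : ℝ) (T : (Fin d → ℤ) → Vec d →L[ℂ] E) (hT : ∀ k, ‖T k‖ ≤ C * weight j r k) :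
    FieldSpace d j r →L[ℂ] E :=
  LinearMap.mkContinuous
    { toFun := fun f => ∑' k, T k (coeff f k)
      map_add' := fun f g => by
        rw [← (summable_apply_coeff hT f).tsum_add (summable_apply_coeff hT g)]
        simp only [FieldSpace.coeff_add, map_add]
      map_smul' := fun c f => by
        rw [RingHom.id_apply, ← tsum_const_smul'']
        exact tsum_congr fun k => by rw [← map_smul]; exact congrArg (T k) (coeff_smul c f k) }
    C fun f => by
      rw [FieldSpace.norm_def, ← tsum_mul_left]
      exact tsum_of_norm_bounded (f.isField.summable.mul_left C).hasSum (norm_apply_coeff_le hT f)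

theorem hasSum_lift (hT : ∀ k, ‖T k‖ ≤ C * weight j r k) (f : FieldSpace d j r) :
    HasSum (fun k => T k (coeff f k)) (lift C T hT f) :=
  (summable_apply_coeff hT f).hasSum

theorem norm_lift_le (hC : 0 ≤ C) (hT : ∀ k, ‖T k‖ ≤ C * weight j r k) : ‖lift C T hT‖ ≤ C :=
  LinearMap.mkContinuous_norm_le _ hC _

end Lift

end FieldSpaces

section Operators

variable {i j : ℕ} {r s : ℝ} {θ : Vec d}

theorem weight_zero (r : ℝ) (k : Fin d → ℤ) : weight 0 r k = Real.exp (r * freqNorm k) := by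
  simp [weight]

theorem weight_eq_mul_weight_zero (j : ℕ) (r : ℝ) (k : Fin d → ℤ) :
    weight j r k = (1 + 2 * π * freqNorm k) ^ j * weight 0 r k := by
  rw [weight_zero, weight]

theorem weight_zero_le_weight (hsr : s ≤ r) (j : ℕ) (k : Fin d → ℤ) :
    weight 0 s k ≤ weight j r k := by
  rw [weight_zero]
  exact (Real.exp_le_exp.mpr (mul_le_mul_of_nonneg_right hsr (freqNorm_nonneg k))).trans
    (exp_le_weight j r k)

section Lift

variable {T : (Fin d → ℤ) → Vec d →L[ℂ] FieldSpace d i s} {C : ℝ}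

theorem hasSum_lift_apply (hT : ∀ k, ‖T k‖ ≤ C * weight j r k) (f : FieldSpace d j r)
    (hθ : θ ∈ strip d s) : HasSum (fun k => T k (coeff f k) θ) (lift C T hT f θ) :=
  (hasSum_lift hT f).mapL (evalL i hθ)

end Lift

section Multiplier

theorem norm_smul_mode_le {m : (Fin d → ℤ) → ℂ} {C : ℝ}
    (hm : ∀ k, ‖m k‖ * weight i s k ≤ C * weight j r k) (k : Fin d → ℤ) :
    ‖m k • mode d i s k‖ ≤ C * weight j r k := by
  rw [norm_smul]
  exact (mul_le_mul_of_nonneg_left (norm_mode_le k) (norm_nonneg _)).trans (hm k)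

/-- The Fourier multiplier that takes a field with coefficients `f_k` to the one with coefficients
`m_k f_k`. -/
def multiplierOp (m : (Fin d → ℤ) → ℂ) (C : ℝ)
    (hm : ∀ k, ‖m k‖ * weight i s k ≤ C * weight j r k) : FieldSpace d j r →L[ℂ] FieldSpace d i s :=
  lift C (fun k => m k • mode d i s k) (norm_smul_mode_le hm)

variable {m : (Fin d → ℤ) → ℂ} {C : ℝ}

theorem norm_multiplierOp_apply_le (hC : 0 ≤ C)
    (hm : ∀ k, ‖m k‖ * weight i s k ≤ C * weight j r k) (f : FieldSpace d j r) :
    ‖multiplierOp m C hm f‖ ≤ C * ‖f‖ :=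
  (multiplierOp m C hm).le_of_opNorm_le (norm_lift_le hC _) f

theorem hasSum_multiplierOp_apply (hm : ∀ k, ‖m k‖ * weight i s k ≤ C * weight j r k)
    (f : FieldSpace d j r) (hθ : θ ∈ strip d s) :
    HasSum (fun k => character k θ • m k • coeff f k) (multiplierOp m C hm f θ) := by
  refine (hasSum_lift_apply (norm_smul_mode_le hm) f hθ).congr_fun fun k => ?_
  rw [smul_apply, ← map_smul, mode_apply k _ hθ]

theorem coeff_multiplierOp (hs : 0 < s) (hm : ∀ k, ‖m k‖ * weight i s k ≤ C * weight j r k)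
    (f : FieldSpace d j r) (k : Fin d → ℤ) :
    coeff (multiplierOp m C hm f) k = m k • coeff f k := by
  have hcoeff : ∀ l, coeffL d i s k ((m l • mode d i s l) (coeff f l)) =
      (Pi.single l (m l • coeff f l) : (Fin d → ℤ) → Vec d) k := fun l => by
    rw [smul_apply, ← map_smul, coeffL_apply, coeff_mode hs]
  refine ((hasSum_lift (norm_smul_mode_le hm) f).mapL (coeffL d i s k)).unique ?_
  simp only [hcoeff]
  simpa only [Pi.single_eq_same] using
    hasSum_single (f := fun l => (Pi.single l (m l • coeff f l) : (Fin d → ℤ) → Vec d) k) k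
      fun l hl => Pi.single_eq_of_ne hl.symm _

end Multiplier

section Projection

theorem norm_indicator_one_mul_weight_le (hsr : s ≤ r) (j : ℕ) (I : Set (Fin d → ℤ))
    (k : Fin d → ℤ) : ‖I.indicator (1 : (Fin d → ℤ) → ℂ) k‖ * weight 0 s k ≤ 1 * weight j r k := by
  refine mul_le_mul ((norm_indicator_le_norm_self _ _).trans ?_) (weight_zero_le_weight hsr j k)
    (weight_pos 0 s k).le zero_le_one
  rw [Pi.one_apply, norm_one]

/-- The Fourier projection onto the modes with index in `I`, followed by the restriction to the
smaller strip `𝒟(s)`. -/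
def projOp (hsr : s ≤ r) (j : ℕ) (I : Set (Fin d → ℤ)) : FieldSpace d j r →L[ℂ] A d s :=
  multiplierOp (I.indicator 1) 1 (norm_indicator_one_mul_weight_le hsr j I)

theorem norm_projOp_apply_le (hsr : s ≤ r) (I : Set (Fin d → ℤ)) (f : FieldSpace d j r) :
    ‖projOp hsr j I f‖ ≤ ‖f‖ :=
  (norm_multiplierOp_apply_le zero_le_one _ f).trans_eq (one_mul _)

theorem coeff_projOp (hs : 0 < s) (hsr : s ≤ r) (I : Set (Fin d → ℤ)) (f : FieldSpace d j r)
    (k : Fin d → ℤ) : coeff (projOp hsr j I f) k = I.indicator (coeff f) k := by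
  rw [projOp, coeff_multiplierOp hs]
  by_cases hk : k ∈ I
  · rw [Set.indicator_of_mem hk, Set.indicator_of_mem hk, Pi.one_apply, one_smul]
  · rw [Set.indicator_of_notMem hk, Set.indicator_of_notMem hk, zero_smul]

theorem projOp_apply (hsr : s ≤ r) (I : Set (Fin d → ℤ)) (f : FieldSpace d j r)
    (hθ : θ ∈ strip d s) : projOp hsr j I f θ = fourierProj I f θ := by
  refine (hasSum_multiplierOp_apply
    (norm_indicator_one_mul_weight_le hsr j I) f hθ).tsum_eq.symm.trans ?_
  rw [fourierProj, tsum_subtype I fun k => character k θ • coeff f k]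
  refine tsum_congr fun k => ?_
  by_cases hk : k ∈ I
  · rw [Set.indicator_of_mem hk, Set.indicator_of_mem hk, Pi.one_apply, one_smul]
  · rw [Set.indicator_of_notMem hk, Set.indicator_of_notMem hk, zero_smul, smul_zero]

end Projection

section Multiplication

theorem norm_mode_comp_le (B : Vec d →L[ℂ] Vec d) (k l : Fin d → ℤ) :
    ‖(mode d 0 s (k + l)).comp B‖ ≤ weight 0 s k * ‖B‖ * weight 0 s l := by
  rcases le_or_gt s 0 with hs | hs
  · have := FieldSpace.subsingleton_of_nonpos (d := d) (j := 0) hs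
    rw [Subsingleton.elim ((mode d 0 s (k + l)).comp B) 0, norm_zero]
    exact mul_nonneg (mul_nonneg (weight_pos 0 s k).le (norm_nonneg B)) (weight_pos 0 s l).le
  · have hweight : weight 0 s (k + l) ≤ weight 0 s k * weight 0 s l := by
      rw [weight_zero, weight_zero, weight_zero, ← Real.exp_add, ← mul_add]
      exact Real.exp_le_exp.mpr (mul_le_mul_of_nonneg_left (freqNorm_add_le k l) hs.le)
    calc ‖(mode d 0 s (k + l)).comp B‖ ≤ ‖mode d 0 s (k + l)‖ * ‖B‖ :=
          ContinuousLinearMap.opNorm_comp_le _ _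
      _ ≤ weight 0 s k * weight 0 s l * ‖B‖ :=
          mul_le_mul_of_nonneg_right ((norm_mode_le _).trans hweight) (norm_nonneg B)
      _ = weight 0 s k * ‖B‖ * weight 0 s l := mul_right_comm _ _ _

theorem lift_mode_comp_apply (k : Fin d → ℤ) (B : Vec d →L[ℂ] Vec d) (g : A d s)
    (hθ : θ ∈ strip d s) :
    lift (weight 0 s k * ‖B‖) (fun l => (mode d 0 s (k + l)).comp B) (norm_mode_comp_le B k) g θ =
      character k θ • B (g θ) := by
  refine (hasSum_lift_apply (norm_mode_comp_le B k) g hθ).unique ?_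
  refine (((g.hasSum_apply hθ).mapL B).const_smul (character k θ)).congr_fun fun l => ?_
  rw [ContinuousLinearMap.comp_apply, mode_apply _ _ hθ, character_add, map_smul, smul_smul]

/-- Multiplication by the matrix-valued function `B e^{2πi k·θ}`, as a linear function of `B`. -/
def mulOp (d : ℕ) (s : ℝ) (k : Fin d → ℤ) : (Vec d →L[ℂ] Vec d) →L[ℂ] A d s →L[ℂ] A d s :=
  LinearMap.mkContinuous
    { toFun := fun B =>
        lift (weight 0 s k * ‖B‖) (fun l => (mode d 0 s (k + l)).comp B) (norm_mode_comp_le B k)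
      map_add' := fun B B' => ContinuousLinearMap.ext fun g =>
        FieldSpace.ext_of_forall_mem_strip fun θ hθ =>
          (lift_mode_comp_apply k (B + B') g hθ).trans <|
            (smul_add _ (B (g θ)) (B' (g θ))).trans <|
              (congrArg₂ (· + ·) (lift_mode_comp_apply k B g hθ)
                (lift_mode_comp_apply k B' g hθ)).symm
      map_smul' := fun c B => ContinuousLinearMap.ext fun g =>
        FieldSpace.ext_of_forall_mem_strip fun θ hθ =>
          (lift_mode_comp_apply k (c • B) g hθ).trans <|
            (smul_comm _ c (B (g θ))).trans <|
              (congrArg (c • ·) (lift_mode_comp_apply k B g hθ)).symm }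
    (weight 0 s k) fun B =>
      norm_lift_le (mul_nonneg (weight_pos 0 s k).le (norm_nonneg B)) (norm_mode_comp_le B k)

theorem norm_mulOp_le (k : Fin d → ℤ) : ‖mulOp d s k‖ ≤ weight 0 s k :=
  LinearMap.mkContinuous_norm_le _ (weight_pos 0 s k).le _

theorem mulOp_apply (k : Fin d → ℤ) (B : Vec d →L[ℂ] Vec d) (g : A d s) (hθ : θ ∈ strip d s) :
    mulOp d s k B g θ = character k θ • B (g θ) :=
  lift_mode_comp_apply k B g hθ

variable {B : (Fin d → ℤ) → Vec d →L[ℂ] Vec d →L[ℂ] Vec d} {C : ℝ}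

theorem norm_mulOp_comp_le (hB : ∀ k, ‖B k‖ ≤ C * (1 + 2 * π * freqNorm k) ^ j)
    (k : Fin d → ℤ) : ‖(mulOp d s k).comp (B k)‖ ≤ C * weight j s k := by
  calc ‖(mulOp d s k).comp (B k)‖ ≤ weight 0 s k * (C * (1 + 2 * π * freqNorm k) ^ j) :=
        (ContinuousLinearMap.opNorm_comp_le _ _).trans
          (mul_le_mul (norm_mulOp_le k) (hB k) (norm_nonneg _) (weight_pos 0 s k).le)
    _ = C * weight j s k := by rw [weight_eq_mul_weight_zero j]; ring

/-- The pointwise product of `g` with the matrix-valued function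
`θ ↦ ∑ B_k(u_k) e^{2πi k·θ}`, as a function of `u` and `g`. -/
def matrixOp (s : ℝ) (j : ℕ) (B : (Fin d → ℤ) → Vec d →L[ℂ] Vec d →L[ℂ] Vec d) (C : ℝ)
    (hB : ∀ k, ‖B k‖ ≤ C * (1 + 2 * π * freqNorm k) ^ j) :
    FieldSpace d j s →L[ℂ] A d s →L[ℂ] A d s :=
  lift C (fun k => (mulOp d s k).comp (B k)) (norm_mulOp_comp_le hB)

theorem hasSum_matrixOp_apply (hB : ∀ k, ‖B k‖ ≤ C * (1 + 2 * π * freqNorm k) ^ j)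
    (u : FieldSpace d j s) (g : A d s) (hθ : θ ∈ strip d s) :
    HasSum (fun k => character k θ • B k (coeff u k) (g θ)) (matrixOp s j B C hB u g θ) := by
  refine (((hasSum_lift (norm_mulOp_comp_le hB) u).mapL
    (ContinuousLinearMap.apply ℂ (A d s) g)).mapL (evalL 0 hθ)).congr_fun fun k => ?_
  exact (mulOp_apply k (B k (coeff u k)) g hθ).symm

theorem norm_smulRightL_freqL_le (k : Fin d → ℤ) :
    ‖ContinuousLinearMap.smulRightL ℂ (Vec d) (Vec d) (freqL k)‖ ≤
      1 * (1 + 2 * π * freqNorm k) ^ 1 := by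
  have hk := freqNorm_nonneg k
  refine ContinuousLinearMap.opNorm_le_bound _ (by positivity) fun v => ?_
  change ‖(freqL k).smulRight v‖ ≤ _
  rw [ContinuousLinearMap.norm_smulRight_apply, one_mul, pow_one]
  exact mul_le_mul_of_nonneg_right ((norm_freqL_le k).trans (by linarith)) (norm_nonneg v)

/-- The operator `J_u : g ↦ (Du) g`, as a function of `u`. -/
def jacobianOp (d : ℕ) (s : ℝ) : A' d s →L[ℂ] A d s →L[ℂ] A d s :=
  matrixOp s 1 (fun k => ContinuousLinearMap.smulRightL ℂ (Vec d) (Vec d) (freqL k)) 1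
    norm_smulRightL_freqL_le

theorem norm_jacobianOp_apply_le (u : A' d s) : ‖jacobianOp d s u‖ ≤ ‖u‖ := by
  simpa only [one_mul] using (jacobianOp d s).le_of_opNorm_le
    (norm_lift_le zero_le_one (norm_mulOp_comp_le norm_smulRightL_freqL_le)) u

theorem jacobianOp_apply (u : A' d s) (g : A d s) (hθ : θ ∈ strip d s) :
    jacobianOp d s u g θ = fderiv ℂ u θ (g θ) := by
  refine (hasSum_matrixOp_apply norm_smulRightL_freqL_le u g hθ).unique ?_
  refine ((u.hasSum_fderiv hθ).mapL (ContinuousLinearMap.apply ℂ (Vec d) (g θ))).congr_fun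
    fun k => ?_
  exact smul_smul (character k θ) (freqL k (g θ)) (coeff u k)

theorem norm_smulRight_freqL_id_le (k l : Fin d → ℤ) :
    ‖(freqL k).smulRight (ContinuousLinearMap.id ℂ (Vec d))‖ ≤
      2 * π * freqNorm k * (1 + 2 * π * freqNorm l) ^ 1 := by
  have hk := freqNorm_nonneg k
  have hl := freqNorm_nonneg l
  rw [ContinuousLinearMap.norm_smulRight_apply]
  refine mul_le_mul (norm_freqL_le k) ?_ (norm_nonneg _) (by positivity)
  refine ContinuousLinearMap.norm_id_le.trans ?_
  rw [pow_one]
  exact le_add_of_nonneg_right (by positivity)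

/-- Multiplication by the scalar function `2πi k·u`, as a function of `u`. -/
def phaseOp (d : ℕ) (s : ℝ) (k : Fin d → ℤ) : A' d s →L[ℂ] A d s →L[ℂ] A d s :=
  matrixOp s 1 (fun _ => (freqL k).smulRight (ContinuousLinearMap.id ℂ (Vec d)))
    (2 * π * freqNorm k) (norm_smulRight_freqL_id_le k)

theorem norm_phaseOp_le (k : Fin d → ℤ) : ‖phaseOp d s k‖ ≤ 2 * π * freqNorm k :=
  norm_lift_le (mul_nonneg (by positivity) (freqNorm_nonneg k))
    (norm_mulOp_comp_le (norm_smulRight_freqL_id_le k))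

theorem phaseOp_apply (k : Fin d → ℤ) (u : A' d s) (g : A d s) (hθ : θ ∈ strip d s) :
    phaseOp d s k u g θ = freqL k (u θ) • g θ := by
  refine (hasSum_matrixOp_apply (norm_smulRight_freqL_id_le k) u g hθ).unique ?_
  refine (((u.hasSum_apply hθ).mapL (freqL k)).smul_const (g θ)).congr_fun fun l => ?_
  rw [ContinuousLinearMap.smulRight_apply, map_smul, smul_eq_mul, mul_smul,
    smul_apply, ContinuousLinearMap.id_apply]

end Multiplication

section Homological

theorem coeff_jacobianOp_constField (hs : 0 < s) (u : A' d s) (c : Vec d) (k : Fin d → ℤ) :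
    coeff (jacobianOp d s u (constField 0 s c)) k = freqL k c • coeff u k := by
  have hm : ∀ k : Fin d → ℤ, ‖freqL k c‖ * weight 0 s k ≤ ‖c‖ * weight 1 s k := fun k => by
    rw [weight_eq_mul_weight_zero 1, pow_one, ← mul_assoc, mul_comm ‖c‖]
    refine mul_le_mul_of_nonneg_right ?_ (weight_pos 0 s k).le
    exact ((freqL k).le_of_opNorm_le (norm_freqL_le k) c).trans
      (mul_le_mul_of_nonneg_right (by linarith) (norm_nonneg c))
  have heq : jacobianOp d s u (constField 0 s c) = multiplierOp (fun k => freqL k c) ‖c‖ hm u :=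
    FieldSpace.ext_of_forall_mem_strip fun θ hθ => by
      refine (hasSum_matrixOp_apply norm_smulRightL_freqL_le u _ hθ).unique ?_
      rw [constField_apply c hθ]
      exact hasSum_multiplierOp_apply hm u hθ
  rw [heq, coeff_multiplierOp hs]

variable {σ : ℝ} {ω : Vec d}

theorem freqL_ne_zero_of_mem_farIndices (hσ : 0 ≤ σ) {k : Fin d → ℤ} (hk : k ∈ farIndices σ ω) :
    freqL k ω ≠ 0 := by
  have hdot : dot ω k ≠ 0 :=
    norm_pos_iff.mp ((mul_nonneg hσ (freqNorm_nonneg k)).trans_lt hk)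
  rw [freqL_apply]
  exact mul_ne_zero Complex.two_pi_I_ne_zero hdot

theorem one_add_freqNorm_le_of_mem_farIndices (hσ : 0 < σ) {k : Fin d → ℤ}
    (hk : k ∈ farIndices σ ω) : 1 + 2 * π * freqNorm k ≤ 2 / σ * ‖freqL k ω‖ := by
  have hk0 : k ≠ 0 := by
    rintro rfl
    exact freqL_ne_zero_of_mem_farIndices hσ.le hk (by simp [freqL_apply, dot])
  have hdiv : freqNorm k ≤ ‖dot ω k‖ / σ := by
    rw [le_div_iff₀ hσ, mul_comm]
    exact hk.le
  have hnorm : ‖freqL k ω‖ = 2 * π * ‖dot ω k‖ := by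
    rw [freqL_apply]
    simp [abs_of_pos Real.pi_pos]
  calc 1 + 2 * π * freqNorm k ≤ 4 * π * freqNorm k := by
        nlinarith [one_le_freqNorm hk0, Real.pi_gt_three]
    _ ≤ 4 * π * (‖dot ω k‖ / σ) := mul_le_mul_of_nonneg_left hdiv (by positivity)
    _ = 2 / σ * ‖freqL k ω‖ := by rw [hnorm]; ring

theorem norm_indicator_inv_mul_weight_le (hσ : 0 < σ) (ω : Vec d) (s : ℝ) (k : Fin d → ℤ) :
    ‖(farIndices σ ω).indicator (fun k => (freqL k ω)⁻¹) k‖ * weight 1 s k ≤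
      2 / σ * weight 0 s k := by
  by_cases hk : k ∈ farIndices σ ω
  · rw [Set.indicator_of_mem hk, norm_inv, weight_eq_mul_weight_zero 1, pow_one, ← mul_assoc]
    refine mul_le_mul_of_nonneg_right ?_ (weight_pos 0 s k).le
    rw [inv_mul_le_iff₀ (norm_pos_iff.mpr (freqL_ne_zero_of_mem_farIndices hσ.le hk)),
      mul_comm ‖freqL k ω‖]
    exact one_add_freqNorm_le_of_mem_farIndices hσ hk
  · rw [Set.indicator_of_notMem hk, norm_zero, zero_mul]
    exact mul_nonneg (by positivity) (weight_pos 0 s k).le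

/-- The solution operator of the homological equation `(Du) ω = 𝕀⁻ g`, where `𝕀⁻` is the projection
onto the far from resonance terms. -/
def solveOp (s : ℝ) (hσ : 0 < σ) (ω : Vec d) : A d s →L[ℂ] A' d s :=
  multiplierOp ((farIndices σ ω).indicator fun k => (freqL k ω)⁻¹) (2 / σ)
    (norm_indicator_inv_mul_weight_le hσ ω s)

theorem norm_solveOp_apply_le (hσ : 0 < σ) (ω : Vec d) (g : A d s) :
    ‖solveOp s hσ ω g‖ ≤ 2 / σ * ‖g‖ :=
  norm_multiplierOp_apply_le (by positivity) _ g

theorem coeff_solveOp (hs : 0 < s) (hσ : 0 < σ) (ω : Vec d) (g : A d s) (k : Fin d → ℤ) :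
    coeff (solveOp s hσ ω g) k =
      (farIndices σ ω).indicator (fun k => (freqL k ω)⁻¹ • coeff g k) k := by
  rw [solveOp, coeff_multiplierOp hs]
  exact (Set.indicator_smul_apply_left (farIndices σ ω) (fun k => (freqL k ω)⁻¹)
    (coeff g) k).symm

theorem jacobianOp_solveOp (hs : 0 < s) (hσ : 0 < σ) (ω : Vec d) (g : A d s) :
    jacobianOp d s (solveOp s hσ ω g) (constField 0 s ω) =
      projOp le_rfl 0 (farIndices σ ω) g := by
  refine FieldSpace.ext_coeff fun k => ?_
  rw [coeff_jacobianOp_constField hs, coeff_solveOp hs, coeff_projOp hs]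
  by_cases hk : k ∈ farIndices σ ω
  · rw [Set.indicator_of_mem hk, Set.indicator_of_mem hk,
      smul_inv_smul₀ (freqL_ne_zero_of_mem_farIndices hσ.le hk)]
  · rw [Set.indicator_of_notMem hk, Set.indicator_of_notMem hk, smul_zero]

theorem projOp_jacobianOp_solveOp (hs : 0 < s) (hσ : 0 < σ) (ω c : Vec d) (g : A d s) :
    projOp le_rfl 0 (resonantIndices σ ω)
      (jacobianOp d s (solveOp s hσ ω g) (constField 0 s c)) = 0 := by
  refine FieldSpace.ext_coeff fun k => ?_
  rw [coeff_projOp hs, Set.indicator_apply_eq_zero.mpr fun hk => ?_]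
  · exact (coeff_zero k).symm
  · rw [coeff_jacobianOp_constField hs, coeff_solveOp hs, Set.indicator_of_notMem hk, smul_zero]

end Homological
end Operators

section Composition

variable {r s : ℝ} {θ : Vec d} {u : A' d s}

theorem summable_exp_neg_mul_freqNorm (d : ℕ) {c : ℝ} (hc : 0 < c) :
    Summable fun k : Fin d → ℤ => Real.exp (-(c * freqNorm k)) := by
  have hnat : Summable fun n : ℕ => Real.exp (-(c * n)) :=
    (Real.summable_exp_nat_mul_iff.mpr (neg_lt_zero.mpr hc)).congr fun n => by ring_nf
  have hint : Summable fun n : ℤ => Real.exp (-(c * |(n : ℝ)|)) := by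
    refine Summable.of_nat_of_neg ?_ ?_ <;> simpa using hnat
  refine (summable_pi_prod (fun _ _ => Real.exp_nonneg _) fun _ : Fin d => hint).congr fun k => ?_
  rw [← Real.exp_sum, freqNorm, Finset.mul_sum, Finset.sum_neg_distrib]

/-- The map that takes an operator `S` to the operator `f ↦ S (f_k e^{2πi k·θ})`. -/
def compModeL (d : ℕ) (s r : ℝ) (k : Fin d → ℤ) :
    (A d s →L[ℂ] A d s) →L[ℂ] A' d r →L[ℂ] A d s :=
  (ContinuousLinearMap.compL ℂ (A' d r) (A d s) (A d s)).flip
    ((mode d 0 s k).comp (coeffL d 1 r k))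

theorem compModeL_apply (k : Fin d → ℤ) (S : A d s →L[ℂ] A d s) (f : A' d r) :
    compModeL d s r k S f = S (mode d 0 s k (coeff f k)) := rfl

theorem norm_mode_coeff_le (f : A' d r) (k : Fin d → ℤ) :
    ‖mode d 0 s k (coeff f k)‖ ≤
      Real.exp (-((r - s) * freqNorm k)) * (weight 1 r k * ‖coeff f k‖) := by
  calc ‖mode d 0 s k (coeff f k)‖ ≤ weight 0 s k * ‖coeff f k‖ :=
        (mode d 0 s k).le_of_opNorm_le (norm_mode_le k) _
    _ = Real.exp (-((r - s) * freqNorm k)) * (Real.exp (r * freqNorm k) * ‖coeff f k‖) := by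
        rw [weight_zero, ← mul_assoc, ← Real.exp_add]
        ring_nf
    _ ≤ _ := mul_le_mul_of_nonneg_left
        (mul_le_mul_of_nonneg_right (exp_le_weight 1 r k) (norm_nonneg _)) (Real.exp_nonneg _)

theorem norm_compModeL_le (k : Fin d → ℤ) :
    ‖compModeL d s r k‖ ≤ Real.exp (-((r - s) * freqNorm k)) := by
  refine ContinuousLinearMap.opNorm_le_bound _ (Real.exp_nonneg _) fun S => ?_
  refine ContinuousLinearMap.opNorm_le_bound _ (by positivity) fun f => ?_
  rw [compModeL_apply]
  calc ‖S (mode d 0 s k (coeff f k))‖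
      ≤ ‖S‖ * (Real.exp (-((r - s) * freqNorm k)) * ‖f‖) :=
        S.le_opNorm_of_le ((norm_mode_coeff_le f k).trans
          (mul_le_mul_of_nonneg_left (f.weight_mul_norm_coeff_le k) (Real.exp_nonneg _)))
    _ = Real.exp (-((r - s) * freqNorm k)) * ‖S‖ * ‖f‖ := by ring

/-- The operator `f ↦ f ∘ (id + u)`, defined through `f ∘ (id + u) = ∑ f_k e^{2πi k·θ} e^{2πi k·u}`.
This is meaningful for `‖u‖ ≤ (r - s) / 4π`, where the series of operators converges. -/
def compOp (d : ℕ) (s r : ℝ) (u : A' d s) : A' d r →L[ℂ] A d s :=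
  ∑' k, compModeL d s r k (exp (phaseOp d s k u))

/-- The power series in `u` of the `k`-th term of `compOp`. -/
def compSeries (d : ℕ) (s r : ℝ) (k : Fin d → ℤ) :
    FormalMultilinearSeries ℂ (A' d s) (A' d r →L[ℂ] A d s) :=
  (compModeL d s r k).compFormalMultilinearSeries
    ((expSeries ℂ (A d s →L[ℂ] A d s)).compContinuousLinearMap (phaseOp d s k))

theorem hasSum_compSeries (k : Fin d → ℤ) (u : A' d s) :
    HasSum (fun n => compSeries d s r k n fun _ => u)
      (compModeL d s r k (exp (phaseOp d s k u))) :=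
  (NormedSpace.expSeries_hasSum_exp (𝕂 := ℂ) (phaseOp d s k u)).mapL (compModeL d s r k)

theorem norm_compSeries_le (k : Fin d → ℤ) (n : ℕ) :
    ‖compSeries d s r k n‖ ≤ Real.exp (-((r - s) * freqNorm k)) *
      ((n.factorial : ℝ)⁻¹ * (2 * π * freqNorm k) ^ n) := by
  refine (ContinuousLinearMap.norm_compContinuousMultilinearMap_le _ _).trans ?_
  refine mul_le_mul (norm_compModeL_le k) ?_ (norm_nonneg _) (Real.exp_nonneg _)
  refine (ContinuousMultilinearMap.norm_compContinuousLinearMap_le _ _).trans ?_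
  simp only [Finset.prod_const, Finset.card_univ, Fintype.card_fin]
  exact mul_le_mul (norm_expSeries_clm_le n)
    (pow_le_pow_left₀ (norm_nonneg _) (norm_phaseOp_le k) n) (by positivity) (by positivity)

theorem summable_norm_compSeries (hsr : s < r) :
    Summable fun x : (Fin d → ℤ) × ℕ =>
      ‖compSeries d s r x.1 x.2‖ * ((r - s) / (4 * π)) ^ x.2 := by
  set R := (r - s) / (4 * π) with hR
  have : 0 ≤ R := div_nonneg (sub_pos.mpr hsr).le (by positivity)
  have hsum : ∀ k : Fin d → ℤ, HasSum (fun n : ℕ => Real.exp (-((r - s) * freqNorm k)) *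
      ((n.factorial : ℝ)⁻¹ * (2 * π * freqNorm k * R) ^ n))
      (Real.exp (-((r - s) / 2 * freqNorm k))) := fun k => by
    convert! (hasSum_exp_series (2 * π * freqNorm k * R)).mul_left
      (Real.exp (-((r - s) * freqNorm k))) using 1
    rw [← Real.exp_add, hR]
    congr 1
    field_simp
    ring
  have hmajorant : Summable fun x : (Fin d → ℤ) × ℕ => Real.exp (-((r - s) * freqNorm x.1)) *
      ((x.2.factorial : ℝ)⁻¹ * (2 * π * freqNorm x.1 * R) ^ x.2) := by
    refine (summable_prod_of_nonneg fun x => ?_).mpr ⟨fun k => (hsum k).summable, ?_⟩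
    · have := freqNorm_nonneg x.1
      rw [Pi.zero_apply]
      positivity
    · simp only [(hsum _).tsum_eq]
      exact summable_exp_neg_mul_freqNorm d (half_pos (sub_pos.mpr hsr))
  refine hmajorant.of_nonneg_of_le (fun x => by positivity) fun x => ?_
  rw [mul_pow, ← mul_assoc (x.2.factorial : ℝ)⁻¹, ← mul_assoc (Real.exp _)]
  exact mul_le_mul_of_nonneg_right (norm_compSeries_le x.1 x.2) (by positivity)

theorem analyticOnNhd_compOp (hsr : s < r) :
    AnalyticOnNhd ℂ (compOp d s r) (ball 0 ((r - s) / (4 * π))) := by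
  have hR : 0 < (r - s) / (4 * π) := div_pos (sub_pos.mpr hsr) (by positivity)
  have hseries : HasFPowerSeriesOnBall (compOp d s r) (fun n => ∑' k, compSeries d s r k n) 0
      ((r - s) / (4 * π)).toNNReal :=
    hasFPowerSeriesOnBall_tsum (Real.toNNReal_pos.mpr hR)
      (by rw [Real.coe_toNNReal _ hR.le]; exact summable_norm_compSeries hsr) hasSum_compSeries
  intro u hu
  refine hseries.analyticOnNhd u ?_
  rw [Metric.mem_eball, ← ENNReal.ofReal, edist_dist]
  exact (ENNReal.ofReal_lt_ofReal_iff hR).mpr hu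

theorem norm_exp_phaseOp_le (hu : ‖u‖ ≤ (r - s) / (4 * π)) (k : Fin d → ℤ) :
    ‖exp (phaseOp d s k u)‖ ≤ Real.exp ((r - s) / 2 * freqNorm k) := by
  refine (norm_exp_clm_le _).trans (Real.exp_le_exp.mpr ?_)
  calc ‖phaseOp d s k u‖ ≤ 2 * π * freqNorm k * ((r - s) / (4 * π)) :=
        (phaseOp d s k).le_of_opNorm_le_of_le (norm_phaseOp_le k) hu
    _ = (r - s) / 2 * freqNorm k := by
        field_simp
        ring

theorem hasSum_compOp (hsr : s < r) (hu : ‖u‖ ≤ (r - s) / (4 * π)) (f : A' d r) :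
    HasSum (fun k => exp (phaseOp d s k u) (mode d 0 s k (coeff f k))) (compOp d s r u f) := by
  have hsum : Summable fun k => compModeL d s r k (exp (phaseOp d s k u)) := by
    refine Summable.of_norm_bounded
      (summable_exp_neg_mul_freqNorm d (half_pos (sub_pos.mpr hsr))) fun k => ?_
    calc ‖compModeL d s r k (exp (phaseOp d s k u))‖
        ≤ Real.exp (-((r - s) * freqNorm k)) * Real.exp ((r - s) / 2 * freqNorm k) :=
          (compModeL d s r k).le_of_opNorm_le_of_le (norm_compModeL_le k)
            (norm_exp_phaseOp_le hu k)
      _ = Real.exp (-((r - s) / 2 * freqNorm k)) := by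
          rw [← Real.exp_add]
          ring_nf
  exact hsum.hasSum.mapL (ContinuousLinearMap.apply ℂ (A d s) f)

theorem norm_compOp_apply_le (hsr : s < r) (hu : ‖u‖ ≤ (r - s) / (4 * π)) (f : A' d r) :
    ‖compOp d s r u f‖ ≤ ‖f‖ := by
  rw [← (hasSum_compOp hsr hu f).tsum_eq]
  refine tsum_of_norm_bounded f.isField.summable.hasSum fun k => ?_
  have hw : 0 ≤ weight 1 r k * ‖coeff f k‖ := mul_nonneg (weight_pos 1 r k).le (norm_nonneg _)
  calc ‖exp (phaseOp d s k u) (mode d 0 s k (coeff f k))‖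
      ≤ Real.exp ((r - s) / 2 * freqNorm k) *
          (Real.exp (-((r - s) * freqNorm k)) * (weight 1 r k * ‖coeff f k‖)) :=
        ContinuousLinearMap.le_of_opNorm_le_of_le _ (norm_exp_phaseOp_le hu k)
          (norm_mode_coeff_le f k)
    _ = Real.exp (-((r - s) / 2 * freqNorm k)) * (weight 1 r k * ‖coeff f k‖) := by
        rw [← mul_assoc, ← Real.exp_add]
        ring_nf
    _ ≤ weight 1 r k * ‖coeff f k‖ := by
        refine mul_le_of_le_one_left hw (Real.exp_le_one_iff.mpr ?_)
        exact neg_nonpos.mpr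
          (mul_nonneg (half_pos (sub_pos.mpr hsr)).le (freqNorm_nonneg k))

theorem add_apply_mem_strip (hsr : s < r) (hu : ‖u‖ ≤ (r - s) / (4 * π)) (hθ : θ ∈ strip d s) :
    θ + u θ ∈ strip d r := by
  refine add_mem_strip hθ ?_
  calc 2 * π * ‖u θ‖ ≤ 2 * π * ((r - s) / (4 * π)) :=
        mul_le_mul_of_nonneg_left ((u.norm_apply_le hθ).trans hu) (by positivity)
    _ = (r - s) / 2 := by
        field_simp
        ring
    _ ≤ r - s := half_le_self (sub_pos.mpr hsr).le

theorem compOp_apply (hsr : s < r) (hu : ‖u‖ ≤ (r - s) / (4 * π)) (f : A' d r)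
    (hθ : θ ∈ strip d s) : compOp d s r u f θ = f (θ + u θ) := by
  refine ((hasSum_compOp hsr hu f).mapL (evalL 0 hθ)).unique ?_
  refine (f.hasSum_apply (add_apply_mem_strip hsr hu hθ)).congr_fun fun k => ?_
  have hphase : ∀ g, evalL 0 hθ (phaseOp d s k u g) = freqL k (u θ) • evalL 0 hθ g :=
    fun g => phaseOp_apply k u g hθ
  rw [map_exp_apply_of_map_apply_eq_smul hphase, evalL_apply, mode_apply _ _ hθ, smul_smul,
    character_apply_add, mul_comm, Complex.exp_eq_exp_ℂ]

theorem compOp_constField (hsr : s < r) (hu : ‖u‖ ≤ (r - s) / (4 * π)) (c : Vec d) :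
    compOp d s r u (constField 1 r c) = constField 0 s c :=
  FieldSpace.ext_of_forall_mem_strip fun θ hθ => by
    rw [compOp_apply hsr hu _ hθ, constField_apply c hθ,
      constField_apply c (add_apply_mem_strip hsr hu hθ)]

theorem projOp_compOp_zero (hs : 0 < s) (hsr : s < r) (I : Set (Fin d → ℤ)) (f : A' d r) :
    projOp le_rfl 0 I (compOp d s r 0 f) = projOp hsr.le 1 I f := by
  have h0 : compOp d s r 0 f = projOp hsr.le 1 Set.univ f :=
    FieldSpace.ext_of_forall_mem_strip fun θ hθ => by
      have hr : ‖(0 : A' d s)‖ ≤ (r - s) / (4 * π) := by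
        rw [norm_zero]
        exact div_nonneg (sub_pos.mpr hsr).le (by positivity)
      have hθ0 : θ + (0 : A' d s) θ = θ := add_zero θ
      rw [compOp_apply hsr hr f hθ, projOp_apply hsr.le Set.univ f hθ, hθ0, fourierProj,
        tsum_univ fun k => character k θ • coeff f k]
      exact (f.hasSum_apply (strip_mono hsr.le hθ)).tsum_eq.symm
  have hcoeff : coeff (projOp hsr.le 1 Set.univ f) = coeff f :=
    funext fun k => by rw [coeff_projOp hs, Set.indicator_univ]
  exact FieldSpace.ext_coeff fun k => by
    rw [h0, coeff_projOp hs, coeff_projOp hs, hcoeff]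

end Composition

section NormalForm

variable {s r σ m : ℝ} {ω : Vec d} {X : A' d r} {u : A' d s}

theorem projOp_farIndices_add_projOp_resonantIndices (hs : 0 < s) (σ : ℝ) (ω : Vec d) (g : A d s) :
    projOp le_rfl 0 (farIndices σ ω) g + projOp le_rfl 0 (resonantIndices σ ω) g = g :=
  FieldSpace.ext_coeff fun k => by
    rw [FieldSpace.coeff_add, coeff_projOp hs, coeff_projOp hs]
    exact Set.indicator_self_add_compl_apply (farIndices σ ω) (coeff g) k

theorem projOp_projOp (hs : 0 < s) (I : Set (Fin d → ℤ)) (g : A d s) :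
    projOp le_rfl 0 I (projOp le_rfl 0 I g) = projOp le_rfl 0 I g :=
  FieldSpace.ext_coeff fun k => by
    have hcoeff : coeff (projOp le_rfl 0 I g) = I.indicator (coeff g) :=
      funext (coeff_projOp hs le_rfl I g)
    rw [coeff_projOp hs, hcoeff, Set.indicator_indicator, Set.inter_self]

theorem zero_notMem_farIndices : (0 : Fin d → ℤ) ∉ farIndices σ ω := by
  simp [farIndices, dot, freqNorm]

theorem projOp_farIndices_constField (hs : 0 < s) (hsr : s ≤ r) (j : ℕ) (c : Vec d) :
    projOp hsr j (farIndices σ ω) (constField j r c) = 0 := by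
  refine FieldSpace.ext_coeff fun k => ?_
  rw [coeff_projOp hs, Set.indicator_apply_eq_zero.mpr fun hk => ?_]
  · exact (coeff_zero k).symm
  · have hk0 : k ≠ 0 := fun h => zero_notMem_farIndices (h ▸ hk)
    rw [← mode_zero_eq_constField, coeff_mode (hs.trans_le hsr), Pi.single_eq_of_ne hk0]

theorem projOp_resonantIndices_constField (hs : 0 < s) (c : Vec d) :
    projOp le_rfl 0 (resonantIndices σ ω) (constField 0 s c) = constField 0 s c := by
  have hsplit := projOp_farIndices_add_projOp_resonantIndices hs σ ω (constField 0 s c)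
  rwa [projOp_farIndices_constField hs, zero_add] at hsplit

theorem solveOp_eq_zero (hs : 0 < s) (hσ : 0 < σ) {g : A d s}
    (hg : projOp le_rfl 0 (farIndices σ ω) g = 0) : solveOp s hσ ω g = 0 := by
  refine FieldSpace.ext_coeff fun k => ?_
  rw [coeff_solveOp hs, Set.indicator_apply_eq_zero.mpr fun hk => ?_]
  · exact (coeff_zero k).symm
  · rw [← Set.indicator_of_mem hk (coeff g), ← coeff_projOp hs le_rfl, hg]
    exact (congrArg _ (coeff_zero k)).trans (smul_zero _)

theorem norm_constField_le (s : ℝ) (c : Vec d) : ‖(constField 0 s c : A d s)‖ ≤ ‖c‖ := by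
  have h := (mode d 0 s 0).le_of_opNorm_le (norm_mode_le 0) c
  rwa [mode_zero_eq_constField, weight_zero, freqNorm_zero, mul_zero, Real.exp_zero, one_mul] at h

/-- The smallness conditions on the radius `m` of the ball of displacements in which the
coordinate change to normal form is sought. -/
structure IsAdmissible (ω : Vec d) (s r σ m : ℝ) : Prop where
  strip_pos : 0 < s
  lt : s < r
  σ_pos : 0 < σ
  pos : 0 < m
  le_strip : m ≤ (r - s) / (4 * π)
  le_tenth : m ≤ 1 / 10
  mul_norm_le : m * ‖ω‖ ≤ σ / 10

/-- The field `(I + Du)⁻¹ ((Du)² ω + (X - ω) ∘ (id + u))`, as a function of `(X, u)`. It is what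
remains of the pullback of `X` by `id + u` beyond its linear part `ω - (Du) ω`. -/
def remainder (s r : ℝ) (ω : Vec d) (z : A' d r × A' d s) : A d s :=
  Ring.inverse (1 + jacobianOp d s z.2)
    (jacobianOp d s z.2 (jacobianOp d s z.2 (constField 0 s ω)) +
      compOp d s r z.2 (z.1 - constField 1 r ω))

theorem isUnit_one_add_jacobianOp (hu : ‖u‖ < 1) : IsUnit (1 + jacobianOp d s u) :=
  isUnit_one_add_of_norm_lt_one ((norm_jacobianOp_apply_le u).trans_lt hu)

theorem one_add_jacobianOp_remainder (hu : ‖u‖ < 1) :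
    remainder s r ω (X, u) + jacobianOp d s u (remainder s r ω (X, u)) =
      jacobianOp d s u (jacobianOp d s u (constField 0 s ω)) +
        compOp d s r u (X - constField 1 r ω) :=
  congrArg (fun T : A d s →L[ℂ] A d s =>
    T (jacobianOp d s u (jacobianOp d s u (constField 0 s ω)) +
      compOp d s r u (X - constField 1 r ω)))
    (Ring.mul_inverse_cancel _ (isUnit_one_add_jacobianOp hu))

theorem norm_jacobianOp_jacobianOp_constField_le (u : A' d s) (ω : Vec d) :
    ‖jacobianOp d s u (jacobianOp d s u (constField 0 s ω))‖ ≤ ‖u‖ * (‖u‖ * ‖ω‖) :=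
  (jacobianOp d s u).le_of_opNorm_le_of_le (norm_jacobianOp_apply_le u)
    ((jacobianOp d s u).le_of_opNorm_le_of_le (norm_jacobianOp_apply_le u)
      (norm_constField_le s ω))

namespace IsAdmissible

theorem norm_remainder_le (h : IsAdmissible ω s r σ m) (X : A' d r) (hu : ‖u‖ ≤ m) :
    ‖remainder s r ω (X, u)‖ ≤ σ / 9 * ‖u‖ + 10 / 9 * ‖X - constField 1 r ω‖ := by
  have hJ := norm_jacobianOp_apply_le u
  have hu' : ‖u‖ ≤ 1 / 10 := hu.trans h.le_tenth
  have hinv : ‖Ring.inverse (1 + jacobianOp d s u)‖ ≤ 10 / 9 := by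
    refine (norm_inverse_one_add_le (hJ.trans_lt (by linarith))).trans ?_
    rw [inv_le_comm₀ (by linarith) (by norm_num)]
    linarith
  have hquad : ‖jacobianOp d s u (jacobianOp d s u (constField 0 s ω))‖ ≤ σ / 10 * ‖u‖ :=
    calc ‖jacobianOp d s u (jacobianOp d s u (constField 0 s ω))‖
        ≤ ‖u‖ * (‖u‖ * ‖ω‖) := norm_jacobianOp_jacobianOp_constField_le u ω
      _ ≤ ‖u‖ * (m * ‖ω‖) := by gcongr
      _ ≤ ‖u‖ * (σ / 10) := by gcongr; exact h.mul_norm_le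
      _ = σ / 10 * ‖u‖ := mul_comm _ _
  have hcomp := norm_compOp_apply_le h.lt (hu.trans h.le_strip) (X - constField 1 r ω)
  calc ‖remainder s r ω (X, u)‖
      ≤ 10 / 9 * (σ / 10 * ‖u‖ + ‖X - constField 1 r ω‖) :=
        ContinuousLinearMap.le_of_opNorm_le_of_le _ hinv (norm_add_le_of_le hquad hcomp)
    _ = σ / 9 * ‖u‖ + 10 / 9 * ‖X - constField 1 r ω‖ := by ring

theorem contDiffAt_remainder (h : IsAdmissible ω s r σ m) (X : A' d r) (hu : ‖u‖ < m) :
    ContDiffAt ℂ ⊤ (remainder s r ω) (X, u) := by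
  have hJ : ContDiffAt ℂ ⊤ (fun z : A' d r × A' d s => jacobianOp d s z.2) (X, u) :=
    (jacobianOp d s).contDiff.contDiffAt.comp (X, u) contDiffAt_snd
  have hC : ContDiffAt ℂ ⊤ (fun z : A' d r × A' d s => compOp d s r z.2) (X, u) :=
    (analyticOnNhd_compOp h.lt u (mem_ball_zero_iff.mpr (hu.trans_le h.le_strip))).contDiffAt.comp
      (X, u) contDiffAt_snd
  have hI : ContDiffAt ℂ ⊤
      (fun z : A' d r × A' d s => Ring.inverse (1 + jacobianOp d s z.2)) (X, u) := by
    obtain ⟨a, ha⟩ := isUnit_one_add_jacobianOp (u := u) (by linarith [h.le_tenth])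
    have hinv := contDiffAt_ringInverse ℂ (n := ⊤) a
    rw [ha] at hinv
    exact hinv.comp (X, u) (contDiffAt_const.add hJ)
  exact hI.clm_apply ((hJ.clm_apply (hJ.clm_apply contDiffAt_const)).add
    (hC.clm_apply (contDiffAt_fst.sub contDiffAt_const)))

/-- The map `(X, u) ↦ (ω·∂)⁻¹ 𝕀⁻ R(X, u)`, where `R` is `remainder`. A displacement `u` for which
the pullback of `X` by `id + u` has no far from resonance terms is a fixed point in `u`. -/
def displacementMap (h : IsAdmissible ω s r σ m) (z : A' d r × A' d s) : A' d s :=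
  solveOp s h.σ_pos ω (remainder s r ω z)

theorem contDiffAt_displacementMap (h : IsAdmissible ω s r σ m) (X : A' d r) (hu : ‖u‖ < m) :
    ContDiffAt ℂ ⊤ h.displacementMap (X, u) :=
  (solveOp s h.σ_pos ω).contDiff.contDiffAt.comp (X, u) (h.contDiffAt_remainder X hu)

theorem differentiableOn_displacementMap (h : IsAdmissible ω s r σ m) (X : A' d r) :
    DifferentiableOn ℂ (fun u => h.displacementMap (X, u)) (ball 0 m) := fun u hu =>
  (((h.contDiffAt_displacementMap X (mem_ball_zero_iff.mp hu)).differentiableAt (by simp)).comp u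
    (hasFDerivAt_prodMk_right X u).differentiableAt).differentiableWithinAt

theorem norm_displacementMap_le (h : IsAdmissible ω s r σ m) (X : A' d r) (hu : ‖u‖ ≤ m) :
    ‖h.displacementMap (X, u)‖ ≤ 2 / 9 * ‖u‖ + 20 / 9 * (‖X - constField 1 r ω‖ / σ) := by
  have hσ := h.σ_pos
  calc ‖h.displacementMap (X, u)‖
      ≤ 2 / σ * ‖remainder s r ω (X, u)‖ := norm_solveOp_apply_le hσ ω _
    _ ≤ 2 / σ * (σ / 9 * ‖u‖ + 10 / 9 * ‖X - constField 1 r ω‖) := by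
        gcongr
        exact h.norm_remainder_le X hu
    _ = 2 / 9 * ‖u‖ + 20 / 9 * (‖X - constField 1 r ω‖ / σ) := by
        field_simp
        ring

theorem mapsTo_displacementMap (h : IsAdmissible ω s r σ m)
    (hX : X ∈ ball (constField 1 r ω) (σ * m / 26)) :
    Set.MapsTo (fun u => h.displacementMap (X, u)) (ball 0 m) (closedBall 0 (4 / 13 * m)) := by
  intro u hu
  rw [mem_ball_zero_iff] at hu
  have hX' : ‖X - constField 1 r ω‖ / σ ≤ m / 26 := by
    rw [div_le_iff₀ h.σ_pos]
    linarith [mem_ball_iff_norm.mp hX]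
  rw [mem_closedBall_zero_iff]
  linarith [h.norm_displacementMap_le X hu.le]

theorem existsUnique_fixedPoint (h : IsAdmissible ω s r σ m)
    (hX : X ∈ ball (constField 1 r ω) (σ * m / 26)) :
    ∃! u : A' d s, u ∈ ball 0 m ∧ h.displacementMap (X, u) = u :=
  existsUnique_fixedPoint_of_mapsTo_ball (h.differentiableOn_displacementMap X)
    (h.mapsTo_displacementMap hX) (by linarith [h.pos]) (by linarith [h.pos])

/-- The displacement `u` of the coordinate change `id + u` which brings `X` into normal form. It is
arbitrary if `X` is too far from `ω` for the fixed point of `displacementMap` to exist. -/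
def displacement (h : IsAdmissible ω s r σ m) (X : A' d r) : A' d s :=
  Classical.epsilon fun u => u ∈ ball 0 m ∧ h.displacementMap (X, u) = u

section Displacement

variable (h : IsAdmissible ω s r σ m) (hX : X ∈ ball (constField 1 r ω) (σ * m / 26))
include hX

theorem displacement_spec :
    h.displacement X ∈ ball 0 m ∧ h.displacementMap (X, h.displacement X) = h.displacement X :=
  Classical.epsilon_spec (h.existsUnique_fixedPoint hX).exists

theorem norm_displacement_lt : ‖h.displacement X‖ < m :=
  mem_ball_zero_iff.mp (h.displacement_spec hX).1

theorem displacementMap_displacement : h.displacementMap (X, h.displacement X) = h.displacement X :=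
  (h.displacement_spec hX).2

theorem eq_displacement (hu : ‖u‖ < m) (hfix : h.displacementMap (X, u) = u) :
    u = h.displacement X :=
  (h.existsUnique_fixedPoint hX).unique ⟨mem_ball_zero_iff.mpr hu, hfix⟩ (h.displacement_spec hX)

theorem norm_displacement_le : ‖h.displacement X‖ ≤ 3 * (‖X - constField 1 r ω‖ / σ) := by
  have hle := h.norm_displacementMap_le X (h.norm_displacement_lt hX).le
  rw [h.displacementMap_displacement hX] at hle
  have : 0 ≤ ‖X - constField 1 r ω‖ / σ := div_nonneg (norm_nonneg _) h.σ_pos.le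
  linarith

theorem contDiffAt_displacement : ContDiffAt ℂ ⊤ h.displacement X := by
  have hm := h.pos
  have hmaps := h.mapsTo_displacementMap hX
  have hmem : h.displacement X ∈ closedBall 0 (4 / 13 * m) := by
    rw [← h.displacementMap_displacement hX]
    exact hmaps (h.displacement_spec hX).1
  have hcontr : ‖fderiv ℂ (fun u => h.displacementMap (X, u)) (h.displacement X)‖ < 1 := by
    refine (norm_fderiv_le_of_mem_closedBall (h.differentiableOn_displacementMap X) hmaps
      (by linarith) hmem).trans_lt ?_
    rw [div_lt_one (by linarith)]
    linarith
  refine contDiffAt_fixedPoint (by simp)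
    (h.contDiffAt_displacementMap X (h.norm_displacement_lt hX)) hcontr
    (h.displacementMap_displacement hX) ?_
  filter_upwards [prod_mem_nhds (isOpen_ball.mem_nhds hX)
    (isOpen_ball.mem_nhds (h.displacement_spec hX).1)] with z hz hfix
  exact h.eq_displacement hz.1 (mem_ball_zero_iff.mp hz.2) hfix

end Displacement

/-- The vector field obtained from `X` by the coordinate change `id + u` to normal form. -/
def normalForm (h : IsAdmissible ω s r σ m) (X : A' d r) : A d s :=
  constField 0 s ω + projOp le_rfl 0 (resonantIndices σ ω) (remainder s r ω (X, h.displacement X))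

theorem projOp_normalForm (h : IsAdmissible ω s r σ m) (X : A' d r) :
    projOp le_rfl 0 (resonantIndices σ ω) (h.normalForm X) = h.normalForm X := by
  rw [normalForm, map_add, projOp_resonantIndices_constField h.strip_pos,
    projOp_projOp h.strip_pos]

section OfMemBall

variable (h : IsAdmissible ω s r σ m) (hX : X ∈ ball (constField 1 r ω) (σ * m / 26))
include hX

theorem contDiffAt_normalForm : ContDiffAt ℂ ⊤ h.normalForm X := by
  have hgraph : ContDiffAt ℂ ⊤ (fun X => (X, h.displacement X)) X :=
    contDiffAt_id.prodMk (h.contDiffAt_displacement hX)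
  have hrem := (h.contDiffAt_remainder X (h.norm_displacement_lt hX)).comp X hgraph
  exact contDiffAt_const.add
    ((projOp le_rfl 0 (resonantIndices σ ω)).contDiff.contDiffAt.comp X hrem)

theorem norm_normalForm_sub_le :
    ‖h.normalForm X - constField 0 s ω‖ ≤ 2 * ‖X - constField 1 r ω‖ := by
  have hσ := h.σ_pos
  rw [normalForm, add_sub_cancel_left]
  calc ‖projOp le_rfl 0 (resonantIndices σ ω) (remainder s r ω (X, h.displacement X))‖
      ≤ ‖remainder s r ω (X, h.displacement X)‖ := norm_projOp_apply_le le_rfl _ _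
    _ ≤ σ / 9 * ‖h.displacement X‖ + 10 / 9 * ‖X - constField 1 r ω‖ :=
        h.norm_remainder_le X (h.norm_displacement_lt hX).le
    _ ≤ σ / 9 * (3 * (‖X - constField 1 r ω‖ / σ)) + 10 / 9 * ‖X - constField 1 r ω‖ := by
        gcongr
        exact h.norm_displacement_le hX
    _ = 13 / 9 * ‖X - constField 1 r ω‖ := by
        field_simp
        ring
    _ ≤ 2 * ‖X - constField 1 r ω‖ := by gcongr; norm_num

theorem normalForm_eq_sub_add : h.normalForm X =
    constField 0 s ω - jacobianOp d s (h.displacement X) (constField 0 s ω) +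
      remainder s r ω (X, h.displacement X) := by
  have hfar := jacobianOp_solveOp h.strip_pos h.σ_pos ω (remainder s r ω (X, h.displacement X))
  rw [show solveOp s h.σ_pos ω (remainder s r ω (X, h.displacement X)) = h.displacement X from
    h.displacementMap_displacement hX] at hfar
  have hsplit := projOp_farIndices_add_projOp_resonantIndices h.strip_pos σ ω
    (remainder s r ω (X, h.displacement X))
  rw [normalForm, hfar, eq_sub_of_add_eq' hsplit]
  abel

theorem normalForm_add_jacobianOp_normalForm :
    h.normalForm X + jacobianOp d s (h.displacement X) (h.normalForm X) =
      compOp d s r (h.displacement X) X := by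
  have hu := h.norm_displacement_lt hX
  have hrem := one_add_jacobianOp_remainder (ω := ω) (X := X) (u := h.displacement X)
    (by linarith [h.le_tenth])
  rw [map_sub, compOp_constField h.lt (hu.le.trans h.le_strip)] at hrem
  rw [h.normalForm_eq_sub_add hX, map_add, map_sub, ← sub_eq_zero]
  rw [← sub_eq_zero] at hrem
  rw [← hrem]
  abel

theorem displacement_eq_zero (hfar : projOp h.lt.le 1 (farIndices σ ω) X = 0) :
    h.displacement X = 0 := by
  have hrem : remainder s r ω (X, 0) = compOp d s r 0 (X - constField 1 r ω) := by
    simp only [remainder, map_zero, add_zero, zero_add, Ring.inverse_one,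
      zero_apply, one_apply_eq_self]
  refine (h.eq_displacement hX (norm_zero.trans_lt h.pos) (solveOp_eq_zero h.strip_pos _ ?_)).symm
  rw [hrem, projOp_compOp_zero h.strip_pos h.lt, map_sub, hfar,
    projOp_farIndices_constField h.strip_pos, sub_zero]

theorem normalForm_eq_constField_add (c : Vec d) :
    h.normalForm X = constField 0 s c + projOp le_rfl 0 (resonantIndices σ ω)
      (compOp d s r (h.displacement X) (X - constField 1 r c) -
        jacobianOp d s (h.displacement X) (h.normalForm X - constField 0 s c)) := by
  have hJ : projOp le_rfl 0 (resonantIndices σ ω)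
      (jacobianOp d s (h.displacement X) (constField 0 s c)) = 0 := by
    rw [← h.displacementMap_displacement hX]
    exact projOp_jacobianOp_solveOp h.strip_pos h.σ_pos ω c _
  have hC := compOp_constField h.lt ((h.norm_displacement_lt hX).le.trans h.le_strip) c
  rw [map_sub, map_sub, hC, ← h.normalForm_add_jacobianOp_normalForm hX, map_sub, map_sub, map_sub,
    map_add, hJ, h.projOp_normalForm, projOp_resonantIndices_constField h.strip_pos]
  abel

end OfMemBall

section ConstField

variable (h : IsAdmissible ω s r σ m) {c : Vec d}
  (hc : constField 1 r c ∈ ball (constField 1 r ω : A' d r) (σ * m / 26))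
include hc

theorem displacement_constField : h.displacement (constField 1 r c) = 0 :=
  h.displacement_eq_zero hc (projOp_farIndices_constField h.strip_pos _ 1 c)

theorem normalForm_constField : h.normalForm (constField 1 r c) = constField 0 s c := by
  have hadd := h.normalForm_add_jacobianOp_normalForm hc
  have hzero : ‖(0 : A' d s)‖ ≤ (r - s) / (4 * π) := norm_zero.trans_le (h.pos.le.trans h.le_strip)
  rwa [h.displacement_constField hc, map_zero, zero_apply, add_zero,
    compOp_constField h.lt hzero] at hadd

theorem hasFDerivAt_normalForm :
    HasFDerivAt h.normalForm (projOp h.lt.le 1 (resonantIndices σ ω)) (constField 1 r c) := by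
  have hu0 := h.displacement_constField hc
  have hu := (h.contDiffAt_displacement hc).differentiableAt (by simp)
  have hN := ((h.contDiffAt_normalForm hc).differentiableAt (by simp)).hasFDerivAt
  have hcomp : DifferentiableAt ℂ (fun X => compOp d s r (h.displacement X)) (constField 1 r c) :=
    DifferentiableAt.comp (g := compOp d s r) _
      (analyticOnNhd_compOp h.lt _ (mem_ball_zero_iff.mpr
        ((h.norm_displacement_lt hc).trans_le h.le_strip))).differentiableAt hu
  have hjac : DifferentiableAt ℂ (fun X => jacobianOp d s (h.displacement X)) (constField 1 r c) :=
    (jacobianOp d s).differentiableAt.comp _ hu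
  have hC := hasFDerivAt_clm_apply_of_eq_zero hcomp
    ((hasFDerivAt_id (𝕜 := ℂ) (constField 1 r c)).sub_const (constField 1 r c)) (sub_self _)
  have hJ := hasFDerivAt_clm_apply_of_eq_zero hjac (hN.sub_const (constField 0 s c))
    (sub_eq_zero.mpr (h.normalForm_constField hc))
  have hP := (((projOp le_rfl 0 (resonantIndices σ ω)).hasFDerivAt.comp _ (hC.sub hJ)).const_add
    (constField 0 s c)).congr_of_eventuallyEq (f₁ := h.normalForm)
    (Filter.eventually_of_mem (isOpen_ball.mem_nhds hc) fun X hX =>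
      h.normalForm_eq_constField_add hX c)
  convert! hP using 1
  ext1 f
  simp only [hu0, map_zero, ContinuousLinearMap.zero_comp, sub_zero,
    ContinuousLinearMap.comp_id, ContinuousLinearMap.comp_apply]
  exact (projOp_compOp_zero h.strip_pos h.lt _ f).symm

end ConstField

end IsAdmissible
end NormalForm

section CoordChange

variable {s r σ m : ℝ} {ω θ : Vec d} {X : A' d r} {u : A' d s}

theorem norm_fderiv_le (u : A' d s) (hθ : θ ∈ strip d s) : ‖fderiv ℂ u θ‖ ≤ ‖u‖ := by
  refine ContinuousLinearMap.opNorm_le_bound _ (norm_nonneg _) fun v => ?_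
  have hJ := jacobianOp_apply u (constField 0 s v) hθ
  rw [constField_apply v hθ] at hJ
  calc ‖fderiv ℂ u θ v‖ ≤ ‖jacobianOp d s u (constField 0 s v)‖ :=
        hJ ▸ FieldSpace.norm_apply_le _ hθ
    _ ≤ ‖u‖ * ‖v‖ := (jacobianOp d s u).le_of_opNorm_le_of_le (norm_jacobianOp_apply_le u)
        (norm_constField_le s v)

theorem hasFDerivAt_id_add (u : A' d s) (hθ : θ ∈ strip d s) :
    HasFDerivAt (fun θ => θ + u θ) (1 + fderiv ℂ u θ) θ :=
  (hasFDerivAt_id θ).add (u.differentiableAt hθ).hasFDerivAt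

theorem isInvertible_one_add_fderiv (hu : ‖u‖ < 1) (hθ : θ ∈ strip d s) :
    (1 + fderiv ℂ u θ).IsInvertible :=
  isInvertible_of_isUnit (isUnit_one_add_of_norm_lt_one ((norm_fderiv_le u hθ).trans_lt hu))

theorem isCoordChange_of_lipschitzOnWith {S T : Set (Vec d)} {U : Vec d → Vec d}
    {U' : Vec d → Vec d →L[ℂ] Vec d} {c : NNReal} (hc : c < 1) (hS : IsOpen S)
    (hmaps : Set.MapsTo U S T) (hU : ∀ θ ∈ S, HasFDerivAt U (U' θ) θ)
    (hinv : ∀ θ ∈ S, (U' θ).IsInvertible)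
    (hlip : LipschitzOnWith c (fun θ => U θ - θ) S) : IsCoordChange U S T := by
  have happ : ApproximatesLinearOn U
      ((ContinuousLinearEquiv.refl ℂ (Vec d) : Vec d ≃L[ℂ] Vec d) : Vec d →L[ℂ] Vec d) S c := by
    intro θ hθ η hη
    have hdist := hlip.dist_le_mul θ hθ η hη
    rw [dist_eq_norm, dist_eq_norm, sub_sub_sub_comm] at hdist
    exact hdist
  have hrefl : Subsingleton (Vec d) ∨ c < ‖((ContinuousLinearEquiv.refl ℂ (Vec d)).symm :
      Vec d →L[ℂ] Vec d)‖₊⁻¹ :=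
    (ContinuousLinearEquiv.refl ℂ (Vec d)).subsingleton_or_nnnorm_symm_pos.imp_right fun h =>
      hc.trans_le ((one_le_inv₀ h).mpr ContinuousLinearMap.norm_id_le)
  let e := happ.toOpenPartialHomeomorph U S hrefl hS
  refine ⟨hmaps, fun θ hθ => (hU θ hθ).differentiableAt.differentiableWithinAt, e.open_target,
    e.symm, ?_, fun θ hθ => e.left_inv hθ⟩
  rintro _ ⟨θ, hθ, rfl⟩
  obtain ⟨L, hL⟩ := hinv θ hθ
  refine (OpenPartialHomeomorph.hasFDerivAt_symm e (f' := L) (a := U θ) ⟨θ, hθ, rfl⟩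
    ?_).differentiableAt.differentiableWithinAt
  rw [show e.symm (U θ) = θ from e.left_inv hθ, hL]
  exact hU θ hθ

theorem isCoordChange_id_add (hsr : s < r) (hu : ‖u‖ ≤ (r - s) / (4 * π)) (hu' : ‖u‖ < 1) :
    IsCoordChange (fun θ => θ + u θ) (strip d s) (strip d r) := by
  refine isCoordChange_of_lipschitzOnWith (c := ‖u‖₊) (U' := fun θ => 1 + fderiv ℂ u θ)
    hu' (isOpen_strip d s) (fun θ hθ => add_apply_mem_strip hsr hu hθ)
    (fun θ hθ => hasFDerivAt_id_add u hθ) (fun θ hθ => isInvertible_one_add_fderiv hu' hθ) ?_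
  simp only [add_sub_cancel_left]
  exact (convex_strip d s).lipschitzOnWith_of_nnnorm_fderiv_le (𝕜 := ℂ)
    (fun θ hθ => u.differentiableAt hθ) (fun θ hθ => norm_fderiv_le u hθ)

namespace IsAdmissible

variable (h : IsAdmissible ω s r σ m)

theorem fourierProj_normalForm (X : A' d r) (hθ : θ ∈ strip d s) :
    fourierProj (farIndices σ ω) (h.normalForm X) θ = 0 := by
  have hsplit := projOp_farIndices_add_projOp_resonantIndices h.strip_pos σ ω (h.normalForm X)
  rw [h.projOp_normalForm, add_eq_right] at hsplit
  rw [← projOp_apply le_rfl _ _ hθ, hsplit]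
  rfl

variable (hX : X ∈ ball (constField 1 r ω) (σ * m / 26))
include hX

theorem norm_displacement_lt_one : ‖h.displacement X‖ < 1 :=
  (h.norm_displacement_lt hX).trans_le (h.le_tenth.trans (by norm_num))

theorem norm_displacement_le_strip : ‖h.displacement X‖ ≤ (r - s) / (4 * π) :=
  (h.norm_displacement_lt hX).le.trans h.le_strip

theorem isInvertible_fderiv (hθ : θ ∈ strip d s) :
    (fderiv ℂ (fun θ => θ + h.displacement X θ) θ).IsInvertible := by
  rw [(hasFDerivAt_id_add (h.displacement X) hθ).fderiv]
  exact isInvertible_one_add_fderiv (h.norm_displacement_lt_one hX) hθ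

theorem normalForm_apply (hθ : θ ∈ strip d s) :
    h.normalForm X θ = pullback (fun θ => θ + h.displacement X θ) X θ := by
  have hadd := congrArg (evalL 0 hθ) (h.normalForm_add_jacobianOp_normalForm hX)
  rw [map_add, evalL_apply, evalL_apply, evalL_apply, jacobianOp_apply _ _ hθ,
    compOp_apply h.lt (h.norm_displacement_le_strip hX) _ hθ] at hadd
  refine ((h.isInvertible_fderiv hX hθ).inverse_apply_eq.mpr ?_).symm
  rw [(hasFDerivAt_id_add (h.displacement X) hθ).fderiv]
  exact hadd.symm

theorem displacement_apply_eq_zero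
    (hfar : ∀ θ ∈ strip d r, fourierProj (farIndices σ ω) X θ = 0) (θ : Vec d) :
    h.displacement X θ = 0 := by
  have hproj : projOp h.lt.le 1 (farIndices σ ω) X = 0 :=
    FieldSpace.ext_of_forall_mem_strip fun θ hθ =>
      (projOp_apply h.lt.le _ X hθ).trans (hfar θ (strip_mono h.lt.le hθ))
  rw [h.displacement_eq_zero hX hproj]
  rfl

end IsAdmissible

end CoordChange

section Radius

variable {ρ ρ' σ w : ℝ} {ω : Vec d}

theorem isAdmissible_min (hρ' : 0 < ρ') (hρ : ρ' < ρ) (hσ : 0 < σ) (hσω : σ < ‖ω‖) :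
    IsAdmissible ω ρ' ρ σ (min ((ρ - ρ') / (4 * π)) ((3 - √6) / 6 * (σ / ‖ω‖))) := by
  have hω : 0 < ‖ω‖ := hσ.trans hσω
  have hlt : √6 < 3 := (Real.sqrt_lt' (by norm_num)).mpr (by norm_num)
  have hgt : 2.4 < √6 := (Real.lt_sqrt (by norm_num)).mpr (by norm_num)
  have hle : (3 - √6) / 6 * (σ / ‖ω‖) ≤ 1 / 10 * (σ / ‖ω‖) :=
    mul_le_mul_of_nonneg_right (by linarith) (div_pos hσ hω).le
  exact
    { strip_pos := hρ'
      lt := hρ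
      σ_pos := hσ
      pos := lt_min (div_pos (sub_pos.mpr hρ) (by positivity))
        (mul_pos (by linarith) (div_pos hσ hω))
      le_strip := min_le_left _ _
      le_tenth := (min_le_right _ _).trans (hle.trans
        (mul_le_of_le_one_right (by norm_num) ((div_le_one hω).mpr hσω.le)))
      mul_norm_le := by
        calc min ((ρ - ρ') / (4 * π)) ((3 - √6) / 6 * (σ / ‖ω‖)) * ‖ω‖
            ≤ 1 / 10 * (σ / ‖ω‖) * ‖ω‖ := by
              gcongr
              exact (min_le_right _ _).trans hle
          _ = σ / 10 := by field_simp }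

theorem radius_le (hσ : 0 ≤ σ)
    (hm : 0 ≤ min ((ρ - ρ') / (4 * π)) ((3 - √6) / 6 * (σ / w))) :
    radius ρ ρ' σ w ≤ σ * min ((ρ - ρ') / (4 * π)) ((3 - √6) / 6 * (σ / w)) / 26 := by
  have hlt : √6 < 2.46 := (Real.sqrt_lt' (by norm_num)).mpr (by norm_num)
  calc radius ρ ρ' σ w
      ≤ 1 / 26 * σ * min ((ρ - ρ') / (4 * π)) ((3 - √6) / 6 * (σ / w)) :=
        mul_le_mul_of_nonneg_right
          (mul_le_mul_of_nonneg_right (by linarith) hσ) hm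
    _ = σ * min ((ρ - ρ') / (4 * π)) ((3 - √6) / 6 * (σ / w)) / 26 := by ring

theorem three_mul_div_le {x : ℝ} (hx : 0 ≤ x) (hσ : 0 < σ) :
    3 * (x / σ) ≤ 6 * (√6 + 2) / σ * x := by
  rw [div_mul_eq_mul_div, ← mul_div_assoc]
  gcongr
  linarith [Real.sqrt_nonneg 6]

theorem two_mul_le {x : ℝ} (hx : 0 ≤ x) (hσ : 0 ≤ σ) (hw : 0 ≤ w) :
    2 * x ≤ 2 * (1 + max (2 / 3 * (3 - √6)) (6 * (√6 + 2) * (w / σ))) * x := by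
  have hmax : 0 ≤ max (2 / 3 * (3 - √6)) (6 * (√6 + 2) * (w / σ)) :=
    le_max_of_le_right (by positivity)
  gcongr
  linarith

end Radius

end

end TorusField

theorem theorem5p2 (d : ℕ) (ρ ρ' σ : ℝ) (ω : Vec d) (hρ' : 0 < ρ') (hρ : ρ' < ρ)
    (hω : ω ≠ 0) (hσ : 0 < σ) (hσω : σ < ‖ω‖) :
    ∃ (U : A' d ρ → Vec d → Vec d) (𝒰 : A' d ρ → A d ρ'),
      (∀ X ∈ Metric.ball (constField 1 ρ ω : A' d ρ) (radius ρ ρ' σ ‖ω‖),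
        IsCoordChange (U X) (strip d ρ') (strip d ρ) ∧
        (∃ u : A' d ρ', (∀ θ ∈ strip d ρ', U X θ = θ + u θ) ∧
          ‖u‖ ≤ 6 * (√6 + 2) / σ * ‖X - constField 1 ρ ω‖) ∧
        (∀ θ ∈ strip d ρ', (fderiv ℂ (U X) θ).IsInvertible ∧ 𝒰 X θ = pullback (U X) X θ) ∧
        (∀ θ ∈ strip d ρ', fourierProj (farIndices σ ω) (𝒰 X) θ = 0) ∧
        ((∀ θ ∈ strip d ρ, fourierProj (farIndices σ ω) X θ = 0) →
          ∀ θ ∈ strip d ρ', U X θ = θ) ∧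
        ‖𝒰 X - constField 0 ρ' ω‖ ≤
          2 * (1 + max (2 / 3 * (3 - √6)) (6 * (√6 + 2) * (‖ω‖ / σ))) *
            ‖X - constField 1 ρ ω‖) ∧
      AnalyticOnNhd ℂ 𝒰 (Metric.ball (constField 1 ρ ω : A' d ρ) (radius ρ ρ' σ ‖ω‖)) ∧
      ∀ ψ : Vec d,
        (constField 1 ρ (ω + ψ) : A' d ρ) ∈
            Metric.ball (constField 1 ρ ω : A' d ρ) (radius ρ ρ' σ ‖ω‖) →
          ∃ L : A' d ρ →L[ℂ] A d ρ',
            (∀ (h : A' d ρ), ∀ θ ∈ strip d ρ', L h θ = fourierProj (resonantIndices σ ω) h θ) ∧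
            HasFDerivAt 𝒰 L (constField 1 ρ (ω + ψ)) := by
  have h := isAdmissible_min hρ' hρ hσ hσω
  have hball := Metric.ball_subset_ball (x := (constField 1 ρ ω : A' d ρ))
    (radius_le hσ.le h.pos.le)
  refine ⟨fun X θ => θ + h.displacement X θ, h.normalForm, fun X hX => ?_,
    fun X hX => (h.contDiffAt_normalForm (hball hX)).analyticAt,
    fun ψ hψ => ⟨projOp hρ.le 1 (resonantIndices σ ω), fun f θ hθ => projOp_apply hρ.le _ f hθ,
      h.hasFDerivAt_normalForm (hball hψ)⟩⟩
  have hX' := hball hX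
  exact ⟨isCoordChange_id_add hρ (h.norm_displacement_le_strip hX')
      (h.norm_displacement_lt_one hX'),
    ⟨h.displacement X, fun _ _ => rfl,
      (h.norm_displacement_le hX').trans (three_mul_div_le (norm_nonneg _) hσ)⟩,
    fun θ hθ => ⟨h.isInvertible_fderiv hX' hθ, h.normalForm_apply hX' hθ⟩,
    fun θ hθ => h.fourierProj_normalForm X hθ,
    fun hfar θ _ => add_eq_left.mpr (h.displacement_apply_eq_zero hX' hfar θ),
    (h.norm_normalForm_sub_le hX').trans (two_mul_le (norm_nonneg _) hσ.le (norm_nonneg _))⟩
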